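/- Let $n,m\ge 0$ be integers and $R>0$. Equip the superspace $\mathbb R^{n+1|2m}$, with even coordinates $x^1,\dots,x^{n+1}$ and odd coordinates $\xi^1,\eta^1,\dots,\xi^m,\eta^m$, with the Euclidean metric $$ds^2=\sum_{i=1}^{n+1}(dx^i)^2+2\sum_{\mu=1}^m d\xi^\mu\,d\eta^\mu ,$$ and let the supersphere $S^{n|2m}_R\subset\mathbb R^{n+1|2m}$ be the compact sub-supermanifold given by $$\sum_{i=1}^{n+1}(x^i)^2+2\sum_{\mu=1}^m \xi^\mu\eta^\mu=R^2 ,$$ with the induced Riemannian metric. In local coordinates $(y,\xi,\eta)$ let $g_{ab}$ be the matrix of this metric and $dV=\sqrt{\operatorname{Ber}(g_{ab})}\,D(y\,|\,\xi^1,\eta^1,\dots,\xi^m,\eta^m)$ its volume element, where $\operatorname{Ber}$ is the Berezinian; in the charts used here the odd coordinates are $\xi^\mu,\eta^\mu$, the even coordinates $y$ are all the $x^j$ with $j\neq i$, and $x^i$ is the solution of the above equation over an open hemisphere $x^i>0$ or $x^i<0$. The total volume $\operatorname{vol}(S^{n|2m}_R)$ is the Berezin integral of $dV$, computed in these charts with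 a smooth partition of unity (its value does not depend on the partition). The Berezin integral over the odd variables is normalized by $\int D(\xi,\eta)\,\eta\,\xi=1$ for each pair, so that $\int_{\mathbb R^{0|2m}}e^{-2\sum_\mu\xi^\mu\eta^\mu}\,D(\xi,\eta)=2^m$. Then $$\operatorname{vol}(S^{n|2m}_R)=2R^{\,n-2m}\,\frac{\pi^{\frac{n+1}{2}}\,2^m}{\Gamma\!\left(\frac{n+1}{2}-m\right)} ,$$ where $1/\Gamma$ is understood as $0$ at the poles $0,-1,-2,\dots$ of $\Gamma$. In particular, the supersphere $S^{2n+1|2m}_R$ has volume $0$ whenever $m>n$. -/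

import Mathlib

open scoped ContDiff

noncomputable section

namespace Supergeometry

/-! ### Grassmann algebra and the odd Berezin integral -/

/-- The real Grassmann algebra on `q` anticommuting generators. -/
abbrev Grassmann (q : ℕ) : Type := ExteriorAlgebra ℝ (Fin q → ℝ)

/-- The `j`-th generator `θ_j` (the `j`-th standard odd coordinate). -/
def theta {q : ℕ} (j : Fin q) : Grassmann q := ExteriorAlgebra.ι ℝ (Pi.single j (1 : ℝ))

/-- The body of an element: its component in degree zero. -/
def body {q : ℕ} (a : Grassmann q) : ℝ := ExteriorAlgebra.algebraMapInv a

/-- The soul of an element: its nilpotent part. -/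
def soul {q : ℕ} (a : Grassmann q) : Grassmann q := a - algebraMap ℝ (Grassmann q) (body a)

/-- The parity component of the Grassmann algebra: `p = 0` gives the even elements, `p = 1` the
odd ones. -/
def parityPart (q : ℕ) (p : ZMod 2) : Submodule ℝ (Grassmann q) :=
  CliffordAlgebra.evenOdd (0 : QuadraticForm ℝ (Fin q → ℝ)) p

/-- The left partial derivative `∂/∂θ_j`. -/
def oddDeriv {q : ℕ} (j : Fin q) : Grassmann q →ₗ[ℝ] Grassmann q :=
  CliffordAlgebra.contractLeft (Q := (0 : QuadraticForm ℝ (Fin q → ℝ))) (LinearMap.proj j)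

/-- The Berezin integral `∫ D(θ_1, …, θ_q) a = ∂_1 ∂_2 ⋯ ∂_q a`, normalized by
`∫ D(θ_1, …, θ_q) θ_q ⋯ θ_1 = 1`. -/
def oddBerezin {q : ℕ} (a : Grassmann q) : ℝ :=
  body ((List.finRange q).foldr (fun j b => oddDeriv j b) a)

/-- The value at an even element of a smooth function of one real variable: Taylor's formula at
the body, which terminates because the soul is nilpotent. -/
def evalSmooth {q : ℕ} (f : ℝ → ℝ) (a : Grassmann q) : Grassmann q :=
  ∑ k ∈ Finset.range (q + 1), (iteratedDeriv k f (body a) / (k.factorial : ℝ)) • soul a ^ k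

/-- The value at a tuple of even elements of a smooth function of `N` real variables, again by
Taylor's formula at the body. -/
def evalSmoothMulti {q N : ℕ} (f : (Fin N → ℝ) → ℝ) (a : Fin N → Grassmann q) : Grassmann q :=
  ∑ k ∈ Finset.range (q + 1), ((k.factorial : ℝ)⁻¹) •
    ∑ i : Fin k → Fin N,
      (iteratedFDeriv ℝ k f (fun A => body (a A)) (fun l => Pi.single (i l) (1 : ℝ))) •
        (List.ofFn fun l => soul (a (i l))).prod

/-! ### Berezinian -/

/-- The determinant of a square matrix by Leibniz' formula. It is only used for matrices whose
entries are even, hence commute with each other. -/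
def leibnizDet {A : Type*} [Ring A] {k : ℕ} (M : Matrix (Fin k) (Fin k) A) : A :=
  ∑ σ : Equiv.Perm (Fin k), ((Equiv.Perm.sign σ : ℤˣ) : ℤ) • (List.ofFn fun i => M (σ i) i).prod

/-- The Berezinian `det (J₀₀ - J₀₁ J₁₁⁻¹ J₁₀) / det J₁₁` of an even block matrix. -/
def berezinian {q n r : ℕ} (J : Matrix (Fin n ⊕ Fin r) (Fin n ⊕ Fin r) (Grassmann q)) :
    Grassmann q :=
  leibnizDet (J.toBlocks₁₁ - J.toBlocks₁₂ * Ring.inverse J.toBlocks₂₂ * J.toBlocks₂₁) *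
    Ring.inverse (leibnizDet J.toBlocks₂₂)

/-! ### Superfunctions and maps between superdomains -/

/-- The coefficient of a Grassmann element at the monomial indexed by `S`. -/
def coeff {q : ℕ} (S : Finset (Fin q)) (a : Grassmann q) : ℝ :=
  (Pi.basisFun ℝ (Fin q)).ExteriorAlgebra.repr a S

/-- `f = ∑ f_S(x) θ^S` is a smooth superfunction over the open set `U`. -/
def SuperSmoothOn {n q : ℕ} (f : (Fin n → ℝ) → Grassmann q) (U : Set (Fin n → ℝ)) : Prop :=
  ∀ S : Finset (Fin q), ContDiffOn ℝ ∞ (fun x => coeff S (f x)) U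

/-- The partial derivative of a superfunction in the `j`-th even coordinate, taken
coefficientwise. -/
def evenDeriv {n q : ℕ} (j : Fin n) (f : (Fin n → ℝ) → Grassmann q) (x : Fin n → ℝ) :
    Grassmann q :=
  ∑ S : Finset (Fin q), (fderiv ℝ (fun y => coeff S (f y)) x (Pi.single j (1 : ℝ))) •
    (Pi.basisFun ℝ (Fin q)).ExteriorAlgebra S

/-- The (left) partial derivative of a superfunction in the coordinate `a`, even or odd. -/
def superDeriv {n q : ℕ} (a : Fin n ⊕ Fin q) (f : (Fin n → ℝ) → Grassmann q)
    (x : Fin n → ℝ) : Grassmann q :=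
  Sum.elim (fun j => evenDeriv j f x) (fun j => oddDeriv j (f x)) a

/-- The parity of a coordinate: `0` for even coordinates, `1` for odd ones. -/
def coordParity {n q : ℕ} : Fin n ⊕ Fin q → ℕ := Sum.elim (fun _ => 0) (fun _ => 1)

/-- A smooth map from a superdomain of dimension `n|q` to `ℝ^{N|Q}`, given by the pullbacks of the
standard coordinates. -/
structure SuperMap (n q N Q : ℕ) where
  domain : Set (Fin n → ℝ)
  isOpen_domain : IsOpen domain
  coord : Fin N ⊕ Fin Q → (Fin n → ℝ) → Grassmann q
  smooth : ∀ A, SuperSmoothOn (coord A) domain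
  parity : ∀ A, ∀ x ∈ domain, coord A x ∈ parityPart q (coordParity A : ZMod 2)

/-- The pullback `Φ^* ρ` of an ordinary smooth function `ρ(x^1, …, x^N)` of the even
coordinates. -/
def SuperMap.pullback {n q N Q : ℕ} (Φ : SuperMap n q N Q) (ρ : (Fin N → ℝ) → ℝ)
    (x : Fin n → ℝ) : Grassmann q :=
  evalSmoothMulti ρ (fun A => Φ.coord (Sum.inl A) x)

/-- The matrix of the metric induced by `Φ` from the constant even metric `G_{AB}` on `ℝ^{N|Q}`:
`g_{ab} = ∑ (-1)^{|A| (|B| + |b|)} (∂_a Φ^A) (∂_b Φ^B) G_{AB}`. -/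
def SuperMap.inducedMetric {n q N Q : ℕ} (Φ : SuperMap n q N Q)
    (G : Matrix (Fin N ⊕ Fin Q) (Fin N ⊕ Fin Q) ℝ) (x : Fin n → ℝ) :
    Matrix (Fin n ⊕ Fin q) (Fin n ⊕ Fin q) (Grassmann q) :=
  Matrix.of fun a b => ∑ A, ∑ B,
    ((-1 : ℝ) ^ (coordParity A * (coordParity B + coordParity b)) * G A B) •
      (superDeriv a (Φ.coord A) x * superDeriv b (Φ.coord B) x)

/-- The density `√(Ber g)` of the Riemannian volume element with respect to the coordinate volume
element `D(x, θ)`. -/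
def SuperMap.volumeDensity {n q N Q : ℕ} (Φ : SuperMap n q N Q)
    (G : Matrix (Fin N ⊕ Fin Q) (Fin N ⊕ Fin Q) ℝ) (x : Fin n → ℝ) : Grassmann q :=
  evalSmooth Real.sqrt (berezinian (Φ.inducedMetric G x))

/-- The function of the even coordinates obtained from `(Φ^* ρ) √(Ber g)` by Berezin integration
over the odd coordinates. -/
def SuperMap.integrand {n q N Q : ℕ} (Φ : SuperMap n q N Q)
    (G : Matrix (Fin N ⊕ Fin Q) (Fin N ⊕ Fin Q) ℝ) (ρ : (Fin N → ℝ) → ℝ)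
    (x : Fin n → ℝ) : ℝ :=
  oddBerezin (Φ.pullback ρ x * Φ.volumeDensity G x)

/-! ### The supersphere in `ℝ^{n+1|2m}` -/

/-- The index of the odd coordinate `ξ^μ` in the order `ξ^1, η^1, …, ξ^m, η^m`. -/
def xiIdx {m : ℕ} (μ : Fin m) : Fin (2 * m) := ⟨2 * μ.1, by omega⟩

/-- The index of the odd coordinate `η^μ` in the order `ξ^1, η^1, …, ξ^m, η^m`. -/
def etaIdx {m : ℕ} (μ : Fin m) : Fin (2 * m) := ⟨2 * μ.1 + 1, by omega⟩

/-- The matrix `G_{AB}` of the Euclidean metric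
`ds² = ∑ (dx^i)² + 2 ∑ dξ^μ dη^μ = dx^A dx^B G_{BA}` on `ℝ^{N|2m}`: the identity matrix in the
even-even block, and `G_{ηξ} = 1 = -G_{ξη}` in the odd-odd block. -/
def euclideanMetric (N m : ℕ) : Matrix (Fin N ⊕ Fin (2 * m)) (Fin N ⊕ Fin (2 * m)) ℝ :=
  Matrix.fromBlocks 1 0 0 (Matrix.of fun i j => ∑ μ : Fin m,
    ((if i = etaIdx μ ∧ j = xiIdx μ then 1 else 0) -
      (if i = xiIdx μ ∧ j = etaIdx μ then 1 else 0)))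

/-- `∑ (x^i)² + 2 ∑ ξ^μ η^μ`, evaluated on the components of a map to `ℝ^{N|2m}`. -/
def SuperMap.scalarSquare {n q N m : ℕ} (Φ : SuperMap n q N (2 * m)) (x : Fin n → ℝ) :
    Grassmann q :=
  ∑ i, Φ.coord (Sum.inl i) x ^ 2 +
    (2 : ℝ) • ∑ μ : Fin m, Φ.coord (Sum.inr (xiIdx μ)) x * Φ.coord (Sum.inr (etaIdx μ)) x

/-- `Φ` is the standard chart of the supersphere `∑ (x^i)² + 2 ∑ ξ^μ η^μ = R²` over the open
hemisphere `ε x^i > 0`: the coordinates are the odd coordinates and all even coordinates other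
than `x^i`, and `x^i` is expressed through them by solving the equation of the supersphere. -/
structure IsHemisphereChart {n m : ℕ} (R : ℝ) (i : Fin (n + 1)) (ε : ℤˣ)
    (Φ : SuperMap n (2 * m) (n + 1) (2 * m)) : Prop where
  domain_eq : Φ.domain = {y | ∑ j, y j ^ 2 < R ^ 2}
  coord_odd : ∀ y ∈ Φ.domain, ∀ j, Φ.coord (Sum.inr j) y = theta j
  coord_even : ∀ y ∈ Φ.domain, ∀ j : Fin n,
    Φ.coord (Sum.inl (i.succAbove j)) y = algebraMap ℝ (Grassmann (2 * m)) (y j)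
  sign : ∀ y ∈ Φ.domain, 0 < ((ε : ℤ) : ℝ) * body (Φ.coord (Sum.inl i) y)
  sphere_eq : ∀ y ∈ Φ.domain,
    Φ.scalarSquare y = algebraMap ℝ (Grassmann (2 * m)) (R ^ 2)

/-- The `2(n+1)` hemisphere charts, which cover the supersphere. -/
def IsHemisphereAtlas {n m : ℕ} (R : ℝ)
    (Φ : Fin (n + 1) × ℤˣ → SuperMap n (2 * m) (n + 1) (2 * m)) : Prop :=
  ∀ α, IsHemisphereChart R α.1 α.2 (Φ α)

/-- A smooth partition of unity near the sphere `|x| = R` in `ℝ^{n+1}`, subordinate to its cover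
by the open hemispheres. Pulled back to the supersphere, it is a partition of unity there. -/
structure IsHemispherePartition {n : ℕ} (R : ℝ)
    (ρ : Fin (n + 1) × ℤˣ → (Fin (n + 1) → ℝ) → ℝ) : Prop where
  smooth : ∀ α, ContDiff ℝ ∞ (ρ α)
  support : ∀ α, ∀ x ∈ tsupport (ρ α), ∑ i, x i ^ 2 = R ^ 2 → 0 < ((α.2 : ℤ) : ℝ) * x α.1
  sum_eq_one : ∀ x : Fin (n + 1) → ℝ, ∑ i, x i ^ 2 = R ^ 2 →
    ∀ᶠ z in nhds x, ∑ α, ρ α z = 1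

/-- The supersphere of radius `R` and dimension `n|2m` has total volume `V` with respect to the
Riemannian volume element of the metric induced from `ℝ^{n+1|2m}`: there are partitions of unity
subordinate to the atlas, and for each of them the Berezin integrals over the charts converge and
add up to `V`. -/
def HasSupersphereVolume (n m : ℕ) (R V : ℝ) : Prop :=
  (∃ Φ : Fin (n + 1) × ℤˣ → SuperMap n (2 * m) (n + 1) (2 * m), IsHemisphereAtlas R Φ) ∧
  (∃ ρ : Fin (n + 1) × ℤˣ → (Fin (n + 1) → ℝ) → ℝ, IsHemispherePartition R ρ) ∧
  ∀ (Φ : Fin (n + 1) × ℤˣ → SuperMap n (2 * m) (n + 1) (2 * m))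
    (ρ : Fin (n + 1) × ℤˣ → (Fin (n + 1) → ℝ) → ℝ),
    IsHemisphereAtlas R Φ → IsHemispherePartition R ρ →
    (∀ α, MeasureTheory.IntegrableOn ((Φ α).integrand (euclideanMetric (n + 1) m) (ρ α))
      (Φ α).domain MeasureTheory.volume) ∧
    ∑ α, ∫ y in (Φ α).domain, (Φ α).integrand (euclideanMetric (n + 1) m) (ρ α) y = V

end Supergeometry

end

noncomputable section

namespace Supergeometry

open MeasureTheory
open scoped Matrix

/-! ### Even elements of the Grassmann algebra -/

/-! In a hemisphere chart put w = R² − ∑ y_j² and ν = 2 ∑ η^μ ξ^μ, which is even and nilpotent. The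
sphere equation says X² = w + ν for the remaining coordinate X = x^i. An even square root is
determined by the sign of its body, so X = ε√(w + ν) in the sense of Taylor's formula
(`IsHemisphereChart.coord_eq`). The induced metric is a constant metric plus the tensor square of
dX. The Berezinian of such a perturbation is 1 plus the squared length of the covector
(`berezinian_add_vecMulVec`), which here equals R²/X². The density is therefore R/√(w + ν).

Hence the whole integrand is h(w + ν) with h(w) = R ρ(y, ε√w)/√w. The Berezin integral keeps only
the power ν^m, with value 2^m m!, so it returns 2^m h^{(m)}(w) (`IsHemisphereChart.integrand_eq`).
As w = u − ∑ y_j² at u = R², the derivatives in w are derivatives in u and can be taken outside the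
integral over y. Up to the factor 2^m R, the chart integral is the m-th derivative at u = R² of a
classical integral Ψ(u).

The substitution w = t² shows that integrating Ψ over u in (a, b] gives twice the integral of the
partition function over the shell a < |x|² ≤ b. Summed over the charts this is twice the volume of
the shell, so with s = (n+1)/2 the sum of the Ψ is 2 π^s u^{s−1}/Γ(s) near R²
(`sum_integral_hemisphereKernel`). Its m-th derivative produces (s−1)⋯(s−m) = Γ(s)/Γ(s−m), which
gives the formula.

The factor 1/√w is singular at the equator. This is harmless because each partition function may be
replaced by one that agrees with it near the sphere and has compact support in an open half space
(`IsHemispherePartition.exists_cutoff`). The kernel then vanishes near w ≤ 0. -/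

theorem body_add {q : ℕ} (a b : Grassmann q) : body (a + b) = body a + body b := map_add _ a b

theorem body_mul {q : ℕ} (a b : Grassmann q) : body (a * b) = body a * body b := map_mul _ a b

theorem body_pow {q : ℕ} (a : Grassmann q) (k : ℕ) : body (a ^ k) = body a ^ k := map_pow _ a k

theorem body_smul {q : ℕ} (r : ℝ) (a : Grassmann q) : body (r • a) = r * body a :=
  map_smul (ExteriorAlgebra.algebraMapInv (R := ℝ) (M := Fin q → ℝ)) r a

theorem body_sum {q : ℕ} {ι : Type*} (s : Finset ι) (f : ι → Grassmann q) :
    body (∑ i ∈ s, f i) = ∑ i ∈ s, body (f i) := map_sum _ _ _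

theorem body_algebraMap {q : ℕ} (r : ℝ) : body (algebraMap ℝ (Grassmann q) r) = r :=
  ExteriorAlgebra.algebraMap_leftInverse _ r

theorem body_one {q : ℕ} : body (1 : Grassmann q) = 1 := map_one _

theorem body_zero {q : ℕ} : body (0 : Grassmann q) = 0 := map_zero _

theorem body_ι {q : ℕ} (v : Fin q → ℝ) : body (ExteriorAlgebra.ι ℝ v) = 0 := by
  simp [body, ExteriorAlgebra.algebraMapInv]

theorem body_theta {q : ℕ} (j : Fin q) : body (theta j) = 0 := body_ι _

theorem ι_mul_ι_swap {q : ℕ} (v w : Fin q → ℝ) :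
    ExteriorAlgebra.ι ℝ v * ExteriorAlgebra.ι ℝ w =
      -(ExteriorAlgebra.ι ℝ w * ExteriorAlgebra.ι ℝ v) :=
  eq_neg_of_add_eq_zero_left (ExteriorAlgebra.ι_add_mul_swap v w)

theorem theta_mul_theta_swap {q : ℕ} (i j : Fin q) :
    (theta i * theta j : Grassmann q) = -(theta j * theta i) := ι_mul_ι_swap _ _

theorem theta_mul_self {q : ℕ} (i : Fin q) : (theta i * theta i : Grassmann q) = 0 :=
  ExteriorAlgebra.ι_sq_zero _

theorem even_commute_ι {q : ℕ} {x : Grassmann q} (hx : x ∈ parityPart q 0) (v : Fin q → ℝ) :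
    Commute x (ExteriorAlgebra.ι ℝ v) := by
  induction x, hx using CliffordAlgebra.even_induction with
  | algebraMap r => exact Algebra.commutes r _
  | add x y hx hy ihx ihy => exact ihx.add_left ihy
  | ι_mul_ι_mul m₁ m₂ x hx ih =>
    refine Commute.mul_left ?_ ih
    change ExteriorAlgebra.ι ℝ m₁ * ExteriorAlgebra.ι ℝ m₂ * ExteriorAlgebra.ι ℝ v =
      ExteriorAlgebra.ι ℝ v * (ExteriorAlgebra.ι ℝ m₁ * ExteriorAlgebra.ι ℝ m₂)
    rw [mul_assoc, ι_mul_ι_swap m₂ v, mul_neg, ← mul_assoc, ι_mul_ι_swap m₁ v, neg_mul, neg_neg,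
      mul_assoc]

/-- Even elements of the Grassmann algebra are central. -/
theorem even_commute {q : ℕ} {x : Grassmann q} (hx : x ∈ parityPart q 0) (y : Grassmann q) :
    Commute x y := by
  induction y using ExteriorAlgebra.induction with
  | algebraMap r => exact (Algebra.commutes r x).symm
  | ι v => exact even_commute_ι hx v
  | mul a b ha hb => exact ha.mul_right hb
  | add a b ha hb => exact ha.add_right hb

theorem even_pow {q : ℕ} {x : Grassmann q} (hx : x ∈ parityPart q 0) (k : ℕ) :
    x ^ k ∈ parityPart q 0 :=
  (CliffordAlgebra.even (0 : QuadraticForm ℝ (Fin q → ℝ))).pow_mem hx k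

theorem even_algebraMap {q : ℕ} (r : ℝ) : algebraMap ℝ (Grassmann q) r ∈ parityPart q 0 :=
  (CliffordAlgebra.even (0 : QuadraticForm ℝ (Fin q → ℝ))).algebraMap_mem r

theorem even_theta_mul_theta {q : ℕ} (i j : Fin q) :
    (theta i * theta j : Grassmann q) ∈ parityPart q 0 :=
  CliffordAlgebra.ι_mul_ι_mem_evenOdd_zero _ _ _

theorem odd_theta {q : ℕ} (i : Fin q) : (theta i : Grassmann q) ∈ parityPart q 1 :=
  CliffordAlgebra.ι_mem_evenOdd_one _ _

/-- The soul of an even element is nilpotent. -/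
theorem isNilpotent_soul {q : ℕ} {x : Grassmann q} (hx : x ∈ parityPart q 0) :
    IsNilpotent (soul x) := by
  have key : ∀ y : Grassmann q, y ∈ parityPart q 0 → soul y ∈ parityPart q 0 := fun y hy =>
    sub_mem hy (even_algebraMap _)
  induction x, hx using CliffordAlgebra.even_induction with
  | algebraMap r =>
    have : soul (algebraMap ℝ (Grassmann q) r) = 0 := by simp [soul, body_algebraMap]
    exact this ▸ IsNilpotent.zero
  | add x y hx hy ihx ihy =>
    have : soul (x + y) = soul x + soul y := by
      simp only [soul, body_add, map_add]; abel
    rw [this]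
    exact (even_commute (key x hx) _).isNilpotent_add ihx ihy
  | ι_mul_ι_mul m₁ m₂ x hx ih =>
    have hb : body (ExteriorAlgebra.ι ℝ m₁ * ExteriorAlgebra.ι ℝ m₂ * x) = 0 := by
      rw [body_mul, body_mul, body_ι, zero_mul, zero_mul]
    -- The product has no body. Once the even cofactor `x` is moved aside, its square repeats `m₁`
    -- and `m₂` and so vanishes.
    refine ⟨2, ?_⟩
    change soul (ExteriorAlgebra.ι ℝ m₁ * ExteriorAlgebra.ι ℝ m₂ * x) ^ 2 = 0
    rw [soul, hb, map_zero, sub_zero, (even_commute hx _).symm.mul_pow, pow_two,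
      mul_assoc (ExteriorAlgebra.ι ℝ m₁), ← mul_assoc (ExteriorAlgebra.ι ℝ m₂),
      ι_mul_ι_swap m₂ m₁, neg_mul, mul_assoc (ExteriorAlgebra.ι ℝ m₁) (ExteriorAlgebra.ι ℝ m₂),
      ExteriorAlgebra.ι_sq_zero, mul_zero, neg_zero, mul_zero, zero_mul]

theorem algebraMap_add_soul {q : ℕ} (x : Grassmann q) :
    algebraMap ℝ (Grassmann q) (body x) + soul x = x := by simp [soul]

/-- A nonzero scalar plus a nilpotent element commuting with it is invertible. -/
theorem isUnit_of_body_ne_zero {q : ℕ} {x : Grassmann q} (hx : x ∈ parityPart q 0)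
    (h : body x ≠ 0) : IsUnit x := by
  rw [← algebraMap_add_soul x, add_comm]
  exact (isNilpotent_soul hx).isUnit_add_right_of_commute
    ((IsUnit.mk0 _ h).map (algebraMap ℝ (Grassmann q))) (Algebra.commutes _ _).symm

/-- An even square root is determined by the sign of its body. -/
theorem even_eq_of_sq_eq {q : ℕ} {x y : Grassmann q} (hx : x ∈ parityPart q 0)
    (hy : y ∈ parityPart q 0) (h : x ^ 2 = y ^ 2) (hb : body x + body y ≠ 0) : x = y := by
  -- Evenness makes x² − y² factor as (x + y)(x − y), and the first factor is a unit.
  have hu : IsUnit (x + y) := isUnit_of_body_ne_zero (add_mem hx hy) (by rwa [body_add])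
  have h0 : (x + y) * (x - y) = 0 := by
    rw [← (even_commute hx y).sq_sub_sq, h, sub_self]
  exact sub_eq_zero.mp (hu.mul_right_eq_zero.mp h0)

/-! ### The odd derivatives -/

theorem oddDeriv_ι_mul {q : ℕ} (j : Fin q) (v : Fin q → ℝ) (b : Grassmann q) :
    oddDeriv j (ExteriorAlgebra.ι ℝ v * b) = v j • b - ExteriorAlgebra.ι ℝ v * oddDeriv j b :=
  CliffordAlgebra.contractLeft_ι_mul _ _ _

theorem oddDeriv_theta_mul {q : ℕ} (j k : Fin q) (b : Grassmann q) :
    oddDeriv j (theta k * b) = (if j = k then b else 0) - theta k * oddDeriv j b := by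
  rw [theta, oddDeriv_ι_mul, Pi.single_apply]
  split_ifs <;> simp

theorem oddDeriv_theta {q : ℕ} (j k : Fin q) :
    oddDeriv j (theta k : Grassmann q) = if j = k then 1 else 0 := by
  rw [theta]
  refine (CliffordAlgebra.contractLeft_ι (0 : QuadraticForm ℝ (Fin q → ℝ)) _ _).trans ?_
  rw [LinearMap.proj_apply, Pi.single_apply]
  split_ifs <;> simp

theorem oddDeriv_algebraMap {q : ℕ} (j : Fin q) (r : ℝ) :
    oddDeriv j (algebraMap ℝ (Grassmann q) r) = 0 :=
  CliffordAlgebra.contractLeft_algebraMap _ _ _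

/-- Leibniz' rule for odd derivatives, with an even left factor. -/
theorem oddDeriv_even_mul {q : ℕ} (j : Fin q) {x : Grassmann q} (hx : x ∈ parityPart q 0)
    (b : Grassmann q) : oddDeriv j (x * b) = oddDeriv j x * b + x * oddDeriv j b := by
  induction x, hx using CliffordAlgebra.even_induction with
  | algebraMap r =>
    rw [oddDeriv_algebraMap, zero_mul, zero_add, ← Algebra.smul_def, map_smul, Algebra.smul_def]
  | add x y hx hy ihx ihy => rw [add_mul, map_add, ihx, ihy, map_add, add_mul, add_mul]; abel
  | ι_mul_ι_mul m₁ m₂ x hx ih =>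
    change oddDeriv j (ExteriorAlgebra.ι ℝ m₁ * ExteriorAlgebra.ι ℝ m₂ * x * b) =
      oddDeriv j (ExteriorAlgebra.ι ℝ m₁ * ExteriorAlgebra.ι ℝ m₂ * x) * b +
        ExteriorAlgebra.ι ℝ m₁ * ExteriorAlgebra.ι ℝ m₂ * x * oddDeriv j b
    simp only [mul_assoc, oddDeriv_ι_mul, ih, mul_sub, sub_mul, mul_add, smul_mul_assoc,
      mul_smul_comm]
    abel

theorem oddDeriv_even_pow {q : ℕ} (j : Fin q) {x : Grassmann q} (hx : x ∈ parityPart q 0)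
    (k : ℕ) : oddDeriv j (x ^ k) = k • (x ^ (k - 1) * oddDeriv j x) := by
  induction k with
  | zero => rw [pow_zero, zero_smul, ← map_one (algebraMap ℝ (Grassmann q)), oddDeriv_algebraMap]
  | succ k ih =>
    rw [pow_succ', oddDeriv_even_mul j hx, ih, Nat.add_sub_cancel, mul_smul_comm, ← mul_assoc]
    rcases Nat.eq_zero_or_pos k with rfl | hk
    · simp
    · rw [← pow_succ', Nat.sub_add_cancel hk, ← ((even_commute hx _).pow_left k).eq, add_smul,
        one_smul, add_comm]

/-! ### The Berezin integral of powers of `2 ∑ η ξ` -/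

/-- The nilpotent element `2 ∑ η^μ ξ^μ = -2 ∑ ξ^μ η^μ`. -/
def oddSquare (m : ℕ) : Grassmann (2 * m) :=
  (2 : ℝ) • ∑ μ : Fin m, theta (etaIdx μ) * theta (xiIdx μ)

theorem finRange_two_mul (m : ℕ) :
    List.finRange (2 * m) = (List.finRange m).flatMap fun μ => [xiIdx μ, etaIdx μ] := by
  have h : List.range (2 * m) = (List.range m).flatMap fun μ => [2 * μ, 2 * μ + 1] := by
    induction m with
    | zero => rfl
    | succ m ih =>
      rw [List.range_succ, List.flatMap_append, ← ih, Nat.mul_succ, List.range_succ,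
        List.range_succ]
      simp
  apply (List.map_injective_iff.mpr Fin.val_injective)
  rw [List.map_coe_finRange_eq_range, h, List.map_flatMap, ← List.map_coe_finRange_eq_range,
    List.flatMap_map]
  rfl

theorem xiIdx_inj {m : ℕ} {μ ν : Fin m} : xiIdx μ = xiIdx ν ↔ μ = ν := by
  simp [xiIdx, Fin.ext_iff]

theorem etaIdx_inj {m : ℕ} {μ ν : Fin m} : etaIdx μ = etaIdx ν ↔ μ = ν := by
  simp [etaIdx, Fin.ext_iff]

theorem xiIdx_ne_etaIdx {m : ℕ} (μ ν : Fin m) : xiIdx μ ≠ etaIdx ν := by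
  simp only [xiIdx, etaIdx, ne_eq, Fin.ext_iff]; omega

theorem even_smul {q : ℕ} (r : ℝ) {x : Grassmann q} (hx : x ∈ parityPart q 0) :
    r • x ∈ parityPart q 0 := Submodule.smul_mem _ r hx

theorem even_oddSquare (m : ℕ) : oddSquare m ∈ parityPart (2 * m) 0 :=
  even_smul _ (sum_mem fun _ _ => even_theta_mul_theta _ _)

theorem body_oddSquare (m : ℕ) : body (oddSquare m) = 0 := by
  simp [oddSquare, body_smul, body_sum, body_mul, body_theta]

theorem theta_mul_theta_sq {q : ℕ} (i j : Fin q) :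
    (theta i * theta j : Grassmann q) ^ 2 = 0 := by
  rw [pow_two, mul_assoc, ← mul_assoc (theta j), theta_mul_theta_swap j i, neg_mul, mul_neg,
    mul_assoc, theta_mul_self, mul_zero, mul_zero, neg_zero]

/-- Up to the factor 2 this is a sum of m commuting square-zero elements, so any product of m + 1 of
them repeats one. -/
theorem oddSquare_pow_succ (m : ℕ) : oddSquare m ^ (m + 1) = 0 := by
  have h : ∀ s : Finset (Fin m),
      (∑ μ ∈ s, (theta (etaIdx μ) * theta (xiIdx μ) : Grassmann (2 * m))) ^ (s.card + 1) = 0 := by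
    intro s
    induction s using Finset.induction_on with
    | empty => simp
    | insert a s ha ih =>
      rw [Finset.sum_insert ha, Finset.card_insert_of_notMem ha]
      exact (even_commute (even_theta_mul_theta _ _) _).add_pow_eq_zero_of_add_le_succ_of_pow_eq_zero
        (theta_mul_theta_sq _ _) ih (by omega)
  have := h Finset.univ
  rw [Finset.card_univ, Fintype.card_fin] at this
  rw [oddSquare, smul_pow, this, smul_zero]

/-- The η-derivative of (e + w)^p brings out 2p ξ. Multiplication by ξ kills e = 2ηξ, so only
w^{p−1} remains beside it, and the ξ-derivative then strips off ξ. -/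
theorem oddDeriv_oddDeriv_pow {m : ℕ} (μ : Fin m) {w : Grassmann (2 * m)}
    (hw : w ∈ parityPart (2 * m) 0) (hξ : oddDeriv (xiIdx μ) w = 0)
    (hη : oddDeriv (etaIdx μ) w = 0) (p : ℕ) :
    oddDeriv (xiIdx μ) (oddDeriv (etaIdx μ)
      (((2 : ℝ) • (theta (etaIdx μ) * theta (xiIdx μ)) + w) ^ p)) = (2 * p : ℝ) • w ^ (p - 1) := by
  set e : Grassmann (2 * m) := (2 : ℝ) • (theta (etaIdx μ) * theta (xiIdx μ)) with he
  have hee : e ∈ parityPart (2 * m) 0 := even_smul _ (even_theta_mul_theta _ _)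
  have hde : oddDeriv (etaIdx μ) e = (2 : ℝ) • theta (xiIdx μ) := by
    rw [he, map_smul, oddDeriv_theta_mul, if_pos rfl, oddDeriv_theta,
      if_neg (xiIdx_ne_etaIdx μ μ).symm, mul_zero, sub_zero]
  have hkill : ∀ k : ℕ, (e + w) ^ k * theta (xiIdx μ) = theta (xiIdx μ) * w ^ k := by
    intro k
    induction k with
    | zero => simp
    | succ k ih =>
      have h0 : e * theta (xiIdx μ) = 0 := by
        rw [he, smul_mul_assoc, mul_assoc, theta_mul_self, mul_zero, smul_zero]
      rw [pow_succ, mul_assoc, add_mul, h0, zero_add, (even_commute hw _).eq, ← mul_assoc, ih,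
        mul_assoc, pow_succ]
  rw [oddDeriv_even_pow _ (add_mem hee hw), map_add, hη, add_zero, hde, mul_smul_comm, hkill,
    ← Nat.cast_smul_eq_nsmul ℝ, smul_smul, map_smul, oddDeriv_theta_mul, if_pos rfl,
    oddDeriv_even_pow _ hw, hξ, mul_zero, smul_zero, mul_zero, sub_zero,
    mul_comm (p : ℝ)]

/-- Each pair contributes twice the current exponent, hence the falling factorial. The remainder `w`
varies in the induction because `foldr` differentiates along the tail first, with the head pair
counted as part of `w`. -/
theorem foldr_oddDeriv_pow {m : ℕ} (L : List (Fin m)) (hL : L.Nodup) {w : Grassmann (2 * m)}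
    (hw : w ∈ parityPart (2 * m) 0)
    (hd : ∀ μ ∈ L, oddDeriv (xiIdx μ) w = 0 ∧ oddDeriv (etaIdx μ) w = 0) (j : ℕ) :
    L.foldr (fun μ b => oddDeriv (xiIdx μ) (oddDeriv (etaIdx μ) b))
      (((L.map fun μ => (2 : ℝ) • (theta (etaIdx μ) * theta (xiIdx μ) : Grassmann (2 * m))).sum
        + w) ^ j) = ((2 : ℝ) ^ L.length * (j.descFactorial L.length : ℝ)) • w ^ (j - L.length) := by
  induction L generalizing w with
  | nil => simp
  | cons μ L ih =>
    rw [List.nodup_cons] at hL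
    have hsmul : ∀ (c : ℝ) (x : Grassmann (2 * m)),
        oddDeriv (xiIdx μ) (oddDeriv (etaIdx μ) (c • x)) =
          c • oddDeriv (xiIdx μ) (oddDeriv (etaIdx μ) x) := fun c x => by
      rw [map_smul, map_smul]
    rw [List.foldr_cons, List.map_cons, List.sum_cons, add_assoc, add_left_comm, ih hL.2, hsmul,
      oddDeriv_oddDeriv_pow μ hw (hd μ (by simp)).1 (hd μ (by simp)).2, smul_smul,
        List.length_cons, Nat.descFactorial_succ, Nat.sub_sub]
    · congr 1
      push_cast; ring
    · exact add_mem (even_smul _ (even_theta_mul_theta _ _)) hw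
    · intro ν hν
      have hne : ν ≠ μ := fun h => hL.1 (h ▸ hν)
      have h1 : xiIdx ν ≠ xiIdx μ := fun h => hne (xiIdx_inj.mp h)
      have h2 : etaIdx ν ≠ etaIdx μ := fun h => hne (etaIdx_inj.mp h)
      have h3 := xiIdx_ne_etaIdx ν μ
      have h4 := (xiIdx_ne_etaIdx μ ν).symm
      have h := hd ν (List.mem_cons_of_mem _ hν)
      constructor <;>
      simp [map_add, oddDeriv_theta_mul, oddDeriv_theta, h1, h2, h3, h4, h.1, h.2]

/-- The Berezin integral of the powers of `2 ∑ η^μ ξ^μ`. -/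
theorem oddBerezin_oddSquare_pow (m k : ℕ) :
    oddBerezin (oddSquare m ^ k) = if k = m then 2 ^ m * (m.factorial : ℝ) else 0 := by
  have h := foldr_oddDeriv_pow (List.finRange m) (List.nodup_finRange m) (zero_mem _)
    (fun μ _ => by simp) k
  have hsum : ((List.finRange m).map fun μ =>
      (2 : ℝ) • (theta (etaIdx μ) * theta (xiIdx μ) : Grassmann (2 * m))).sum = oddSquare m := by
    rw [oddSquare, Finset.smul_sum, ← List.ofFn_eq_map, List.sum_ofFn]
  rw [hsum, add_zero, List.length_finRange] at h
  rw [oddBerezin, finRange_two_mul, List.foldr_flatMap]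
  simp only [List.foldr_cons, List.foldr_nil]
  rw [h, body_smul, body_pow, body_zero]
  rcases lt_trichotomy k m with hk | rfl | hk
  · rw [Nat.descFactorial_eq_zero_iff_lt.mpr hk, if_neg hk.ne]; simp
  · simp [Nat.descFactorial_self]
  · rw [if_neg hk.ne', zero_pow (by omega), mul_zero]

theorem oddBerezin_smul {q : ℕ} (r : ℝ) (a : Grassmann q) :
    oddBerezin (r • a) = r * oddBerezin a := by
  have : ∀ L : List (Fin q), L.foldr (fun j b => oddDeriv j b) (r • a) =
      r • L.foldr (fun j b => oddDeriv j b) a := by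
    intro L
    induction L with
    | nil => rfl
    | cons j L ih => rw [List.foldr_cons, ih, map_smul, List.foldr_cons]
  rw [oddBerezin, this, body_smul, oddBerezin]

theorem oddBerezin_add {q : ℕ} (a b : Grassmann q) :
    oddBerezin (a + b) = oddBerezin a + oddBerezin b := by
  have : ∀ L : List (Fin q), L.foldr (fun j b => oddDeriv j b) (a + b) =
      L.foldr (fun j b => oddDeriv j b) a + L.foldr (fun j b => oddDeriv j b) b := by
    intro L
    induction L with
    | nil => rfl
    | cons j L ih => rw [List.foldr_cons, ih, map_add, List.foldr_cons, List.foldr_cons]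
  rw [oddBerezin, this, body_add, oddBerezin, oddBerezin]

theorem oddBerezin_sum {q : ℕ} {ι : Type*} (s : Finset ι) (f : ι → Grassmann q) :
    oddBerezin (∑ i ∈ s, f i) = ∑ i ∈ s, oddBerezin (f i) := by
  have h0 : oddBerezin (0 : Grassmann q) = 0 := by
    simpa using oddBerezin_smul (0 : ℝ) (0 : Grassmann q)
  exact map_sum (AddMonoidHom.mk' oddBerezin oddBerezin_add) f s

/-! ### Determinants -/

/-- If all `2 × 2` permanents of `P` vanish, then `det (1 + P) = (1 - tr P)⁻¹`. -/
theorem det_one_add_mul_one_sub_trace {C : Type*} [CommRing C] {k : ℕ}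
    (P : Matrix (Fin k) (Fin k) C) (hperm : ∀ i j i' j', P i j * P i' j' = -(P i j' * P i' j))
    (hcol : ∀ i j i', P i j * P i' j = 0) : (1 + P).det * (1 - P.trace) = 1 := by
  induction k with
  | zero => simp [Matrix.trace]
  | succ k ih =>
    set e := P 0 0 with he
    -- Subtracting multiples of row 0 clears column 0. The multiplier is `P i 0` itself because `P i
    -- 0 * e = 0` by `hcol`.
    let B : Matrix (Fin (k + 1)) (Fin (k + 1)) C := Matrix.of fun i j =>
      if i = 0 then (1 + P) 0 j else (1 + P) i j - P i 0 * (1 + P) 0 j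
    have hB : (1 + P).det = B.det := by
      refine Matrix.det_eq_of_forall_row_eq_smul_add_const (fun i => if i = 0 then 0 else P i 0) 0
        (if_pos rfl) fun i j => ?_
      by_cases hi : i = 0
      · subst hi; simp [B]
      · simp [B, hi]
    -- The eliminated entries are P_ij − P_i0 P_0j, which `hperm` turns into (1 + e) P_ij. So the
    -- minor is again 1 plus a matrix of the same kind. At the end e² = 0 gives (1 + e)(1 − tr P) =
    -- 1 − tr Q.
    let Q : Matrix (Fin k) (Fin k) C := (1 + e) • P.submatrix Fin.succ Fin.succ
    have hQ : ∀ i j, Q i j = (1 + e) * P i.succ j.succ := fun i j => rfl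
    have hdet : B.det = (1 + e) * (1 + Q).det := by
      rw [Matrix.det_succ_column_zero, Fin.sum_univ_succ, Finset.sum_eq_zero, add_zero]
      · have h1 : B.submatrix (Fin.succAbove 0) Fin.succ = 1 + Q := by
          ext i j
          have h2 : B i.succ j.succ = (1 + P) i.succ j.succ - P i.succ 0 * (1 + P) 0 j.succ := by
            simp [B]
          have h3 : (1 : Matrix (Fin (k + 1)) (Fin (k + 1)) C) 0 j.succ = 0 :=
            Matrix.one_apply_ne (Fin.succ_ne_zero j).symm
          have h4 : (1 : Matrix (Fin (k + 1)) (Fin (k + 1)) C) i.succ j.succ =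
              (1 : Matrix (Fin k) (Fin k) C) i j := by simp [Matrix.one_apply]
          rw [Matrix.submatrix_apply, Fin.zero_succAbove, h2, Matrix.add_apply, Matrix.add_apply,
            Matrix.add_apply, hQ, h3, h4, zero_add, hperm i.succ 0 0 j.succ]
          ring
        rw [h1]
        simp [B, he]
      · intro i _
        have : B i.succ 0 = 0 := by
          have h2 : B i.succ 0 = (1 + P) i.succ 0 - P i.succ 0 * (1 + P) 0 0 := by simp [B]
          rw [h2, Matrix.add_apply, Matrix.add_apply, Matrix.one_apply_eq,
            Matrix.one_apply_ne (Fin.succ_ne_zero i), mul_add, hcol]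
          ring
        rw [this]; ring
    have hQ1 := ih Q (fun i j i' j' => by
      rw [hQ, hQ, hQ, hQ]
      linear_combination (1 + e) ^ 2 * hperm i.succ j.succ i'.succ j'.succ) (fun i j i' => by
      rw [hQ, hQ]
      linear_combination (1 + e) ^ 2 * hcol i.succ j.succ i'.succ)
    have htr : P.trace = e + (P.submatrix Fin.succ Fin.succ).trace := by
      rw [Matrix.trace, Fin.sum_univ_succ]; rfl
    have htQ : Q.trace = (1 + e) * (P.submatrix Fin.succ Fin.succ).trace := by
      rw [Matrix.trace_smul, smul_eq_mul]
    rw [htQ] at hQ1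
    have hee : e * e = 0 := hcol 0 0 0
    rw [hB, hdet, htr]
    linear_combination hQ1 - (1 + Q).det * hee

/-- Entries in the centre of the Grassmann algebra form matrices over a commutative ring. This
carries determinant theory from there to `leibnizDet`. -/
theorem leibnizDet_map {A B : Type*} [CommRing A] [Ring B] (f : A →+* B) {k : ℕ}
    (M : Matrix (Fin k) (Fin k) A) : leibnizDet (M.map f) = f M.det := by
  rw [leibnizDet, Matrix.det_apply, map_sum]
  refine Finset.sum_congr rfl fun σ _ => ?_
  rw [Units.smul_def, map_zsmul, ← List.prod_ofFn, map_list_prod, List.map_ofFn]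
  rfl

theorem ringInverse_eq {M : Type*} [Ring M] {a b : M} (h1 : a * b = 1) (h2 : b * a = 1) :
    Ring.inverse a = b := Ring.inverse_unit ⟨a, b, h1, h2⟩

/-- The Berezinian of the constant metric with blocks `1` and `J`, perturbed by the tensor square
of a covector with even components `p` and odd components `r`. -/
theorem berezinian_add_vecMulVec {q n k : ℕ} (J K : Matrix (Fin k) (Fin k) ℝ) (hJK : J * K = 1)
    (hJ : J.det = 1) (p : Fin n → Grassmann q) (r : Fin k → Grassmann q)
    (hp : ∀ i x, Commute (p i) x) (hr : ∀ i j, r i * r j = -(r j * r i))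
    (hrr : ∀ i j x, Commute (r i * r j) x) :
    berezinian (Matrix.fromBlocks (1 + Matrix.vecMulVec p p) (Matrix.vecMulVec p r)
      (Matrix.vecMulVec r p) (J.map (algebraMap ℝ (Grassmann q)) + Matrix.vecMulVec r r)) =
      1 + r ⬝ᵥ (K.map (algebraMap ℝ (Grassmann q)) *ᵥ r) + p ⬝ᵥ p := by
  set J' : Matrix (Fin k) (Fin k) (Grassmann q) := J.map (algebraMap ℝ (Grassmann q)) with hJ'
  set K' : Matrix (Fin k) (Fin k) (Grassmann q) := K.map (algebraMap ℝ (Grassmann q)) with hK'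
  set u : Fin k → Grassmann q := K' *ᵥ r with hu
  set τ : Grassmann q := r ⬝ᵥ u with hτ
  have hJK' : J' * K' = 1 := by rw [hJ', hK', ← Matrix.map_mul, hJK]; simp
  have hKJ' : K' * J' = 1 := by rw [hJ', hK', ← Matrix.map_mul, mul_eq_one_comm.mp hJK]; simp
  have hui : ∀ i, u i = ∑ j, K i j • r j := fun i => by
    simp [hu, Matrix.mulVec, dotProduct, hK', Algebra.smul_def]
  have hur : ∀ i j, u i * r j = -(r j * u i) := fun i j => by
    rw [hui, Finset.sum_mul, Finset.mul_sum, ← Finset.sum_neg_distrib]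
    refine Finset.sum_congr rfl fun l _ => ?_
    rw [smul_mul_assoc, hr, mul_smul_comm, smul_neg]
  have hurc : ∀ i j x, Commute (u i * r j) x := fun i j x => by
    rw [hui, Finset.sum_mul]
    refine Commute.sum_left _ _ _ fun l _ => ?_
    rw [smul_mul_assoc]
    exact (hrr l j x).smul_left _
  have hτc : ∀ x, Commute τ x := fun x => by
    refine Commute.sum_left _ _ _ fun l _ => ?_
    rw [← neg_eq_iff_eq_neg.mpr (hur l l)]
    exact (hurc l l x).neg_left
  have hJu : J' *ᵥ u = r := by rw [hu, Matrix.mulVec_mulVec, hJK', Matrix.one_mulVec]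
  let C := Subalgebra.center ℝ (Grassmann q)
  have hC : ∀ x : Grassmann q, (∀ y, Commute x y) → x ∈ C := fun x hx =>
    Subalgebra.mem_center_iff.mpr fun y => (hx y).eq.symm
  have hrsq : ∀ j, r j * r j = 0 := fun j => by
    have h : (2 : ℝ) • (r j * r j) = 0 := by
      rw [two_smul]; nth_rewrite 1 [hr j j]; exact neg_add_cancel _
    exact (smul_eq_zero.mp h).resolve_left two_ne_zero
  have hquad : ∀ a b c e, u a * r b * (u c * r e) = -(u a * (u c * (r b * r e))) :=
    fun a b c e => by
      rw [mul_assoc, ← mul_assoc (r b), ← neg_eq_iff_eq_neg.mpr (hur c b), neg_mul, mul_neg,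
        mul_assoc]
  -- The entries u_i r_j are products of two odd elements. Exchanging the two factors r changes the
  -- sign and repeating one gives zero, which are the two hypotheses of
  -- `det_one_add_mul_one_sub_trace`.
  let P : Matrix (Fin k) (Fin k) C := Matrix.of fun i j => ⟨u i * r j, hC _ (hurc i j)⟩
  have hP := det_one_add_mul_one_sub_trace P (fun i j i' j' => Subtype.ext (by
      change u i * r j * (u i' * r j') = -(u i * r j' * (u i' * r j))
      rw [hquad, hquad, hr j j', mul_neg, mul_neg])) (fun i j i' => Subtype.ext (by
      change u i * r j * (u i' * r j) = 0
      rw [hquad, hrsq, mul_zero, mul_zero, neg_zero]))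
  set d : Grassmann q := C.val (1 + P).det with hd
  -- Since r_i u_i = −u_i r_i, the determinant `d` of 1 + u rᵀ is (1 + τ)⁻¹, the inverse of what it
  -- would be for even vectors.
  have htr : C.val P.trace = -τ := by
    rw [Matrix.trace, map_sum, hτ, dotProduct, ← Finset.sum_neg_distrib]
    exact Finset.sum_congr rfl fun i _ => hur i i
  have hdτ : d * (1 + τ) = 1 := by
    have h : C.val (1 + P).det * (1 - C.val P.trace) = 1 :=
      (map_mul C.val _ _).symm.trans (congrArg C.val hP)
    rwa [htr, sub_neg_eq_add] at h
  have hdc : ∀ x, Commute d x := fun x => (Subalgebra.mem_center_iff.mp ((1 + P).det).2 x).symm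
  have hτd : (1 + τ) * d = 1 := by rw [← (hdc _).eq, hdτ]
  have hJ22 : J' + Matrix.vecMulVec r r = J' * (1 + Matrix.vecMulVec u r) := by
    rw [mul_add, mul_one, Matrix.mul_vecMulVec, hJu]
  have hdet : leibnizDet (J' + Matrix.vecMulVec r r) = d := by
    have h1 : J' + Matrix.vecMulVec r r =
        (J.map (algebraMap ℝ C) * (1 + P)).map (C.val : C →+* Grassmann q) := by
      rw [hJ22, Matrix.map_mul, Matrix.map_add _ (map_add _), Matrix.map_one _ (map_zero _)
        (map_one _)]
      rfl
    rw [h1, leibnizDet_map, Matrix.det_mul, ← RingHom.mapMatrix_apply, ← RingHom.map_det, hJ,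
      map_one, one_mul]
    rfl
  have hUU : Matrix.vecMulVec u r * Matrix.vecMulVec u r = τ • Matrix.vecMulVec u r := by
    ext i j
    rw [Matrix.vecMulVec_mul_vecMulVec, Matrix.smul_apply, Matrix.vecMulVec_apply,
      Matrix.vecMulVec_apply, Pi.smul_apply, smul_eq_mul, smul_eq_mul, ← hτ, ← mul_assoc,
      ← (hτc (u i)).eq, mul_assoc]
  have hdm : ∀ M N : Matrix (Fin k) (Fin k) (Grassmann q), M * d • N = d • (M * N) := by
    intro M N
    ext i j
    simp only [Matrix.mul_apply, Matrix.smul_apply, smul_eq_mul, Finset.mul_sum]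
    exact Finset.sum_congr rfl fun l _ => by rw [← mul_assoc, ← (hdc _).eq, mul_assoc]
  -- The Sherman–Morrison inverse of 1 + u rᵀ is 1 − d u rᵀ, because (u rᵀ)² = τ u rᵀ and d + dτ =
  -- 1.
  have hinv : Ring.inverse (J' + Matrix.vecMulVec r r) =
      (1 - d • Matrix.vecMulVec u r) * K' := by
    have h1 : d + d * τ = 1 := by rw [← hdτ, mul_add, mul_one]
    have h2 : (1 + Matrix.vecMulVec u r) * (1 - d • Matrix.vecMulVec u r) = 1 := by
      rw [mul_sub, mul_one, hdm, add_mul, one_mul, hUU, smul_add, smul_smul, ← add_smul, h1,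
        one_smul, add_sub_cancel_right]
    have h3 : (1 - d • Matrix.vecMulVec u r) * (1 + Matrix.vecMulVec u r) = 1 := by
      rw [sub_mul, one_mul, Matrix.smul_mul, mul_add, mul_one, hUU, smul_add, smul_smul,
        ← add_smul, h1, one_smul, add_sub_cancel_right]
    rw [hJ22]
    refine ringInverse_eq ?_ ?_
    · rw [mul_assoc, ← mul_assoc (1 + _), h2, one_mul, hJK']
    · rw [mul_assoc, ← mul_assoc K', hKJ', one_mul, h3]
  have hKr : (1 - d • Matrix.vecMulVec u r) * K' * Matrix.vecMulVec r p =
      Matrix.vecMulVec (d • u) p := by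
    rw [Matrix.mul_assoc, Matrix.mul_vecMulVec, ← hu, Matrix.mul_vecMulVec, Matrix.sub_mulVec,
      Matrix.one_mulVec]
    congr 1
    ext i
    have : ((d • Matrix.vecMulVec u r) *ᵥ u) i = d * (τ * u i) := by
      simp only [Matrix.mulVec, dotProduct, Matrix.smul_apply, smul_eq_mul, Matrix.vecMulVec_apply]
      rw [(hτc (u i)).eq, hτ, dotProduct, Finset.mul_sum, Finset.mul_sum]
      exact Finset.sum_congr rfl fun l _ => by simp only [mul_assoc]
    rw [Pi.sub_apply, this, Pi.smul_apply, smul_eq_mul]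
    have h1 : u i = d * (u i + τ * u i) := by
      rw [← one_add_mul, ← mul_assoc, hdτ, one_mul]
    nth_rewrite 1 [h1]
    rw [mul_add, add_sub_cancel_right]
  -- The correction term is dτ · p pᵀ, and 1 − dτ = d. Dividing det(1 + d p pᵀ) = 1 + d (p·p) by d
  -- then gives 1 + τ + p·p.
  have hschur : (1 + Matrix.vecMulVec p p) - Matrix.vecMulVec p r *
      Ring.inverse (J' + Matrix.vecMulVec r r) * Matrix.vecMulVec r p =
      1 + Matrix.vecMulVec (d • p) p := by
    rw [hinv, Matrix.mul_assoc, hKr, Matrix.vecMulVec_mul_vecMulVec]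
    ext i j
    have h0 : r ⬝ᵥ (d • u) = d * τ := by
      simp only [dotProduct, Pi.smul_apply, smul_eq_mul, hτ, Finset.mul_sum]
      exact Finset.sum_congr rfl fun l _ => by rw [← mul_assoc, ← (hdc _).eq, mul_assoc]
    rw [h0]
    simp only [Matrix.sub_apply, Matrix.add_apply, Matrix.vecMulVec_apply, Pi.smul_apply,
      smul_eq_mul]
    have h2 : p i * p j = d * (p i * p j) + p i * (d * τ * p j) := by
      have h1 : p i * (d * τ * p j) = d * τ * (p i * p j) := by
        rw [← mul_assoc, (hp i _).eq, mul_assoc]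
      rw [h1, ← add_mul]
      rw [← mul_one_add, hdτ, one_mul]
    nth_rewrite 1 [h2]
    rw [mul_assoc d (p i)]
    abel
  have hdet2 : leibnizDet (1 + Matrix.vecMulVec (d • p) p) = 1 + d * (p ⬝ᵥ p) := by
    let p' : Fin n → C := fun i => ⟨p i, hC _ (hp i)⟩
    let d' : C := (1 + P).det
    have h1 : 1 + Matrix.vecMulVec (d • p) p =
        (1 + Matrix.replicateCol Unit (d' • p') * Matrix.replicateRow Unit p').map
          (C.val : C →+* Grassmann q) := by
      rw [Matrix.map_add _ (map_add _), Matrix.map_one _ (map_zero _) (map_one _),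
        ← Matrix.vecMulVec_eq]
      rfl
    rw [h1, leibnizDet_map, Matrix.det_one_add_replicateCol_mul_replicateRow, dotProduct_smul,
      map_add, map_one, smul_eq_mul, map_mul]
    congr 2
    rw [dotProduct, map_sum]
    rfl
  rw [berezinian, Matrix.toBlocks_fromBlocks₁₁, Matrix.toBlocks_fromBlocks₁₂,
    Matrix.toBlocks_fromBlocks₂₁, Matrix.toBlocks_fromBlocks₂₂, hschur, hdet2, hdet,
    ringInverse_eq hdτ hτd, add_mul, one_mul, (hdc _).eq, mul_assoc, hdτ, mul_one]

/-! ### Taylor's formula at a nilpotent element -/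

theorem contDiffAt_deriv {f : ℝ → ℝ} {a : ℝ} (hf : ContDiffAt ℝ ∞ f a) :
    ContDiffAt ℝ ∞ (deriv f) a := by
  have h : deriv f = fun x => fderiv ℝ f x 1 := by ext x; exact fderiv_apply_one_eq_deriv.symm
  rw [h]
  exact (hf.fderiv_right (m := ∞) (by simp)).clm_apply contDiffAt_const

theorem contDiffAt_iteratedDeriv {f : ℝ → ℝ} {a : ℝ} (hf : ContDiffAt ℝ ∞ f a) (k : ℕ) :
    ContDiffAt ℝ ∞ (iteratedDeriv k f) a := by
  induction k with
  | zero => rwa [iteratedDeriv_zero]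
  | succ k ih => rw [iteratedDeriv_succ]; exact contDiffAt_deriv ih

theorem contDiffAt_nat {f : ℝ → ℝ} {a : ℝ} (hf : ContDiffAt ℝ ∞ f a) (k : ℕ) :
    ContDiffAt ℝ k f a := hf.of_le (by exact_mod_cast le_top)

/-- Composition preserves the order of vanishing. The derivative of h ∘ f is (h′ ∘ f) f′, and every
Leibniz term of its derivatives contains a lower derivative of h′ ∘ f. -/
theorem iteratedDeriv_comp_eq_zero {N : ℕ} {h f : ℝ → ℝ} {a : ℝ} (hf : ContDiffAt ℝ ∞ f a)
    (hh : ContDiffAt ℝ ∞ h (f a)) (h0 : ∀ j < N, iteratedDeriv j h (f a) = 0) :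
    ∀ j < N, iteratedDeriv j (h ∘ f) a = 0 := by
  induction N generalizing h with
  | zero => intro j hj; omega
  | succ N ih =>
    rintro (_ | j) hj
    · simpa using h0 0 hj
    · have hev : deriv (h ∘ f) =ᶠ[nhds a] (deriv h ∘ f) * deriv f := by
        have h1 := (hf.of_le (m := 1) (by simp)).eventually (by simp)
        have h2 := hf.continuousAt.eventually ((hh.of_le (m := 1) (by simp)).eventually (by simp))
        filter_upwards [h1, h2] with x hx1 hx2
        exact deriv_comp x (hx2.differentiableAt (by simp)) (hx1.differentiableAt (by simp))
      have hd := contDiffAt_deriv hh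
      rw [iteratedDeriv_succ', hev.iteratedDeriv_eq, iteratedDeriv_mul
        (contDiffAt_nat (hd.comp a hf) j) (contDiffAt_nat (contDiffAt_deriv hf) j)]
      refine Finset.sum_eq_zero fun i hi => ?_
      rw [ih hd (fun l hl => by rw [← iteratedDeriv_succ']; exact h0 _ (by omega)) i
        (by rw [Finset.mem_range] at hi; omega), mul_zero, zero_mul]

theorem iteratedDeriv_sub_pow (b : ℝ) (k j : ℕ) :
    iteratedDeriv j (fun t : ℝ => (t - b) ^ k) b = if j = k then (k.factorial : ℝ) else 0 := by
  rw [iteratedDeriv_comp_sub_const j (fun t : ℝ => t ^ k)]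
  simp only [iteratedDeriv_pow, sub_self]
  rcases lt_trichotomy j k with h | rfl | h
  · rw [if_neg h.ne, zero_pow (by omega), mul_zero]
  · simp [Nat.descFactorial_self]
  · rw [if_neg h.ne', Nat.descFactorial_eq_zero_iff_lt.mpr h]; simp

section TaylorEval

variable {A : Type*} [Ring A] [Algebra ℝ A]

/-- The truncated Taylor expansion of `f` at `a`, evaluated at `a + z`. -/
def taylorEval (N : ℕ) (f : ℝ → ℝ) (a : ℝ) (z : A) : A :=
  ∑ k ∈ Finset.range N, (iteratedDeriv k f a / (k.factorial : ℝ)) • z ^ k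

theorem evalSmooth_eq_taylorEval {q : ℕ} (f : ℝ → ℝ) (x : Grassmann q) :
    evalSmooth f x = taylorEval (q + 1) f (body x) (soul x) := rfl

theorem taylorEval_congr {N : ℕ} {f g : ℝ → ℝ} {a : ℝ} (h : f =ᶠ[nhds a] g) (z : A) :
    taylorEval N f a z = taylorEval N g a z :=
  Finset.sum_congr rfl fun k _ => by rw [h.iteratedDeriv_eq]

theorem taylorEval_add {N : ℕ} {f g : ℝ → ℝ} {a : ℝ} (hf : ContDiffAt ℝ ∞ f a)
    (hg : ContDiffAt ℝ ∞ g a) (z : A) :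
    taylorEval N (f + g) a z = taylorEval N f a z + taylorEval N g a z := by
  rw [taylorEval, taylorEval, taylorEval, ← Finset.sum_add_distrib]
  refine Finset.sum_congr rfl fun k _ => ?_
  rw [iteratedDeriv_add (contDiffAt_nat hf k) (contDiffAt_nat hg k), add_div, add_smul]

theorem taylorEval_const_mul {N : ℕ} (c : ℝ) (f : ℝ → ℝ) (a : ℝ) (z : A) :
    taylorEval N (fun t => c * f t) a z = c • taylorEval N f a z := by
  rw [taylorEval, taylorEval, Finset.smul_sum]
  refine Finset.sum_congr rfl fun k _ => ?_
  rw [iteratedDeriv_const_mul_field, mul_div_assoc, mul_smul]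

theorem taylorEval_sum {N : ℕ} {ι : Type*} (s : Finset ι) {f : ι → ℝ → ℝ} {a : ℝ}
    (hf : ∀ i ∈ s, ContDiffAt ℝ ∞ (f i) a) (z : A) :
    taylorEval N (fun t => ∑ i ∈ s, f i t) a z = ∑ i ∈ s, taylorEval N (f i) a z := by
  simp only [taylorEval]
  rw [Finset.sum_comm]
  refine Finset.sum_congr rfl fun k _ => ?_
  rw [iteratedDeriv_fun_sum fun i hi => contDiffAt_nat (hf i hi) k, Finset.sum_div,
    Finset.sum_smul]

theorem taylorEval_eq_zero {N : ℕ} {f : ℝ → ℝ} {a : ℝ} (h : ∀ j < N, iteratedDeriv j f a = 0)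
    (z : A) : taylorEval N f a z = 0 :=
  Finset.sum_eq_zero fun k hk => by rw [h k (Finset.mem_range.mp hk), zero_div, zero_smul]

theorem taylorEval_sub_pow {N : ℕ} {a : ℝ} {z : A} (hz : z ^ N = 0) (k : ℕ) :
    taylorEval N (fun t => (t - a) ^ k) a z = z ^ k := by
  rw [taylorEval]
  have h : ∀ j ∈ Finset.range N, (iteratedDeriv j (fun t : ℝ => (t - a) ^ k) a /
      (j.factorial : ℝ)) • z ^ j = if j = k then z ^ k else 0 := by
    intro j _
    rw [iteratedDeriv_sub_pow]
    split_ifs with hj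
    · rw [hj, div_self (by exact_mod_cast k.factorial_ne_zero), one_smul]
    · simp
  rw [Finset.sum_congr rfl h, Finset.sum_ite_eq']
  split_ifs with hk
  · rfl
  · rw [Finset.mem_range, not_lt] at hk
    exact (pow_eq_zero_of_le hk hz).symm

theorem taylorEval_const {N : ℕ} (c : ℝ) {a : ℝ} {z : A} (hz : z ^ N = 0) :
    taylorEval N (fun _ => c) a z = algebraMap ℝ A c := by
  have h := taylorEval_const_mul (N := N) c (fun t => (t - a) ^ 0) a z
  rw [taylorEval_sub_pow hz, pow_zero, ← Algebra.algebraMap_eq_smul_one] at h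
  simpa using h

theorem taylorEval_id {N : ℕ} {a : ℝ} {z : A} (hz : z ^ N = 0) :
    taylorEval N (fun t => t) a z = algebraMap ℝ A a + z := by
  have h := taylorEval_add (N := N) (f := fun _ => a) (g := fun t => (t - a) ^ 1) (a := a)
    contDiffAt_const (by fun_prop) z
  rw [taylorEval_sub_pow hz, taylorEval_const a hz, pow_one] at h
  rw [← h]
  congr 1
  ext t
  simp

/-- Leibniz' rule yields the diagonal sums of the Cauchy product. The terms missing from the
truncated sum have degree at least N in z and vanish. -/
theorem taylorEval_mul {N : ℕ} {f g : ℝ → ℝ} {a : ℝ} (hf : ContDiffAt ℝ ∞ f a)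
    (hg : ContDiffAt ℝ ∞ g a) {z : A} (hz : z ^ N = 0) :
    taylorEval N (f * g) a z = taylorEval N f a z * taylorEval N g a z := by
  have h1 : ∀ k, (iteratedDeriv k (f * g) a / (k.factorial : ℝ)) • z ^ k =
      ∑ i ∈ Finset.range (k + 1), ((iteratedDeriv i f a / (i.factorial : ℝ)) •  z ^ i) *
        ((iteratedDeriv (k - i) g a / ((k - i).factorial : ℝ)) • z ^ (k - i)) := by
    intro k
    rw [iteratedDeriv_mul (contDiffAt_nat hf k) (contDiffAt_nat hg k), Finset.sum_div,
      Finset.sum_smul]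
    refine Finset.sum_congr rfl fun i hi => ?_
    have hi' : i ≤ k := by rw [Finset.mem_range] at hi; omega
    rw [smul_mul_smul_comm, ← pow_add, Nat.add_sub_cancel' hi', Nat.cast_choose ℝ hi']
    congr 1
    have := Nat.factorial_ne_zero k
    field_simp
  rw [taylorEval, Finset.sum_congr rfl fun k _ => h1 k,
    Finset.sum_range_diag_flip N fun i j => ((iteratedDeriv i f a / (i.factorial : ℝ)) •  z ^ i) *
        ((iteratedDeriv j g a / (j.factorial : ℝ)) • z ^ j),
    taylorEval, taylorEval, Finset.sum_mul_sum]
  refine Finset.sum_congr rfl fun i _ => ?_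
  refine Finset.sum_subset (Finset.range_mono (Nat.sub_le _ _)) fun j _ hj => ?_
  rw [Finset.mem_range, not_lt] at hj
  rw [smul_mul_smul_comm, ← pow_add, pow_eq_zero_of_le (by omega) hz, smul_zero]

theorem taylorEval_pow {N : ℕ} {f : ℝ → ℝ} {a : ℝ} (hf : ContDiffAt ℝ ∞ f a) {z : A}
    (hz : z ^ N = 0) (k : ℕ) : taylorEval N (f ^ k) a z = taylorEval N f a z ^ k := by
  induction k with
  | zero =>
    rw [pow_zero, pow_zero]
    exact (taylorEval_const 1 hz).trans (map_one _)
  | succ k ih => rw [pow_succ, pow_succ, taylorEval_mul (f := f ^ k) (hf.pow k) hf hz, ih]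

theorem taylorEval_sub_const {N : ℕ} {f : ℝ → ℝ} {a : ℝ} (hf : ContDiffAt ℝ ∞ f a) {z : A}
    (hz : z ^ N = 0) (c : ℝ) :
    taylorEval N (fun t => f t - c) a z = taylorEval N f a z - algebraMap ℝ A c := by
  have h := taylorEval_add (N := N) (f := f) (g := fun _ => -c) hf contDiffAt_const z
  rw [taylorEval_const _ hz, map_neg, ← sub_eq_add_neg] at h
  rw [← h]
  congr 1

theorem taylorEval_sub_pow_eq {N : ℕ} {f : ℝ → ℝ} {a : ℝ} (hf : ContDiffAt ℝ ∞ f a) {z : A}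
    (hz : z ^ N = 0) (c : ℝ) (k : ℕ) :
    taylorEval N (fun t => (f t - c) ^ k) a z = (taylorEval N f a z - algebraMap ℝ A c) ^ k := by
  rw [← taylorEval_sub_const hf hz, ← taylorEval_pow (hf.sub contDiffAt_const) hz]
  rfl

/-- Taylor's formula is compatible with composition. -/
theorem taylorEval_comp {N : ℕ} {f g : ℝ → ℝ} {a : ℝ} (hf : ContDiffAt ℝ ∞ f a)
    (hg : ContDiffAt ℝ ∞ g (f a)) {z : A} (hz : z ^ N = 0) :
    taylorEval N g (f a) (taylorEval N f a z - algebraMap ℝ A (f a)) =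
      taylorEval N (g ∘ f) a z := by
  set c : ℕ → ℝ := fun j => iteratedDeriv j g (f a) / (j.factorial : ℝ) with hc
  -- The Taylor polynomial of g at f(a). For P the claim is linearity and multiplicativity of
  -- `taylorEval`. The remainder g − P vanishes to order N and stays so after composing with f,
  -- hence contributes nothing.
  set P : ℝ → ℝ := fun t => ∑ j ∈ Finset.range N, c j * (t - f a) ^ j with hP
  have hPs : ContDiff ℝ ∞ P := by rw [hP]; fun_prop
  have hflat : ∀ j < N, iteratedDeriv j (g - P) (f a) = 0 := by
    intro j hj
    rw [iteratedDeriv_sub (contDiffAt_nat hg j) (contDiffAt_nat hPs.contDiffAt j), hP,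
      iteratedDeriv_fun_sum fun i _ => by fun_prop]
    simp only [iteratedDeriv_const_mul_field, iteratedDeriv_sub_pow, mul_ite, mul_zero]
    rw [Finset.sum_ite_eq, if_pos (Finset.mem_range.mpr hj), hc, div_mul_cancel₀ _
      (by exact_mod_cast j.factorial_ne_zero), sub_self]
  have hgP : ContDiffAt ℝ ∞ (g - P) (f a) := hg.sub hPs.contDiffAt
  have hsplit : g ∘ f = P ∘ f + (g - P) ∘ f := by ext t; simp
  rw [hsplit, taylorEval_add (hPs.contDiffAt.comp a hf) (hgP.comp a hf),
    taylorEval_eq_zero (iteratedDeriv_comp_eq_zero hf hgP hflat), add_zero]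
  have hPf : P ∘ f = fun t => ∑ j ∈ Finset.range N, c j * (f t - f a) ^ j := rfl
  rw [hPf, taylorEval_sum _ fun j _ => contDiffAt_const.mul ((hf.sub contDiffAt_const).pow j)]
  refine Finset.sum_congr rfl fun j _ => ?_
  rw [taylorEval_const_mul, taylorEval_sub_pow_eq hf hz]

end TaylorEval

theorem body_taylorEval {q N : ℕ} (f : ℝ → ℝ) (a : ℝ) {z : Grassmann q} (hz : body z = 0) :
    body (taylorEval (N + 1) f a z) = f a := by
  rw [taylorEval, body_sum, Finset.sum_range_succ', Finset.sum_eq_zero]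
  · simp [body_smul, body_one]
  · intro k _
    rw [body_smul, body_pow, hz, zero_pow (Nat.succ_ne_zero k), mul_zero]

theorem evalSmooth_taylorEval {q : ℕ} {f g : ℝ → ℝ} {a : ℝ} (hf : ContDiffAt ℝ ∞ f a)
    (hg : ContDiffAt ℝ ∞ g (f a)) {z : Grassmann q} (hz : z ^ (q + 1) = 0) (hb : body z = 0) :
    evalSmooth g (taylorEval (q + 1) f a z) = taylorEval (q + 1) (g ∘ f) a z := by
  rw [evalSmooth_eq_taylorEval, soul, body_taylorEval f a hb, taylorEval_comp hf hg hz]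

theorem even_taylorEval {q : ℕ} (N : ℕ) (f : ℝ → ℝ) (a : ℝ) {z : Grassmann q}
    (hz : z ∈ parityPart q 0) : taylorEval N f a z ∈ parityPart q 0 :=
  sum_mem fun k _ => even_smul _ (even_pow hz k)

theorem oddSquare_pow_eq_zero (m : ℕ) : oddSquare m ^ (2 * m + 1) = 0 :=
  pow_eq_zero_of_le (by omega) (oddSquare_pow_succ m)

/-- Only the m-th power has a nonzero integral, 2^m m!, and its factorial cancels that of the Taylor
coefficient. -/
theorem oddBerezin_taylorEval_oddSquare (m : ℕ) (f : ℝ → ℝ) (a : ℝ) :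
    oddBerezin (taylorEval (2 * m + 1) f a (oddSquare m)) = 2 ^ m * iteratedDeriv m f a := by
  rw [taylorEval, oddBerezin_sum, Finset.sum_eq_single m]
  · rw [oddBerezin_smul, oddBerezin_oddSquare_pow, if_pos rfl]
    have := Nat.factorial_ne_zero m
    field_simp
  · intro k _ hk
    rw [oddBerezin_smul, oddBerezin_oddSquare_pow, if_neg hk, mul_zero]
  · intro h
    exact absurd (Finset.mem_range.mpr (by omega)) h

/-! ### Even derivatives of superfunctions -/

theorem coeff_smul {q : ℕ} (S : Finset (Fin q)) (r : ℝ) (a : Grassmann q) :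
    coeff S (r • a) = r * coeff S a := by simp [coeff]

theorem coeff_sum {q : ℕ} (S : Finset (Fin q)) {ι : Type*} (s : Finset ι)
    (f : ι → Grassmann q) : coeff S (∑ i ∈ s, f i) = ∑ i ∈ s, coeff S (f i) := by
  simp [coeff, map_sum, Finset.sum_apply']

theorem sum_coeff_smul {q : ℕ} (a : Grassmann q) :
    ∑ S, coeff S a • (Pi.basisFun ℝ (Fin q)).ExteriorAlgebra S = a :=
  (Pi.basisFun ℝ (Fin q)).ExteriorAlgebra.sum_repr a

theorem evenDeriv_congr {n q : ℕ} (j : Fin n) {f g : (Fin n → ℝ) → Grassmann q}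
    {x : Fin n → ℝ} (h : f =ᶠ[nhds x] g) : evenDeriv j f x = evenDeriv j g x := by
  refine Finset.sum_congr rfl fun S _ => ?_
  have hS : (fun y => coeff S (f y)) =ᶠ[nhds x] fun y => coeff S (g y) :=
    h.fun_comp (coeff S)
  rw [hS.fderiv_eq]

theorem evenDeriv_sum_smul {n q : ℕ} (j : Fin n) {ι : Type*} (s : Finset ι)
    (g : ι → (Fin n → ℝ) → ℝ) (v : ι → Grassmann q) {x : Fin n → ℝ}
    (hg : ∀ i ∈ s, DifferentiableAt ℝ (g i) x) :
    evenDeriv j (fun y => ∑ i ∈ s, g i y • v i) x =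
      ∑ i ∈ s, fderiv ℝ (g i) x (Pi.single j 1) • v i := by
  have h : ∀ S : Finset (Fin q), fderiv ℝ (fun y => coeff S (∑ i ∈ s, g i y • v i)) x
      (Pi.single j (1 : ℝ)) = ∑ i ∈ s, fderiv ℝ (g i) x (Pi.single j 1) * coeff S (v i) := by
    intro S
    have h1 : (fun y => coeff S (∑ i ∈ s, g i y • v i)) =
        fun y => ∑ i ∈ s, g i y * coeff S (v i) := by
      ext y
      rw [coeff_sum]
      simp only [coeff_smul]
    rw [h1, fderiv_fun_sum fun i hi => (hg i hi).mul_const _, sum_apply]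
    refine Finset.sum_congr rfl fun i hi => ?_
    rw [fderiv_mul_const (hg i hi), smul_apply, smul_eq_mul, mul_comm]
  rw [evenDeriv]
  simp only [h, Finset.sum_smul]
  rw [Finset.sum_comm]
  refine Finset.sum_congr rfl fun i _ => ?_
  simp only [mul_smul]
  rw [← Finset.smul_sum, sum_coeff_smul]

/-- Expanding both factors in monomials makes the product a finite sum of scalar functions times
constant elements, so the scalar product rule suffices. -/
theorem evenDeriv_mul {n q : ℕ} (j : Fin n) {f g : (Fin n → ℝ) → Grassmann q} {x : Fin n → ℝ}
    (hf : ∀ S, DifferentiableAt ℝ (fun y => coeff S (f y)) x)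
    (hg : ∀ S, DifferentiableAt ℝ (fun y => coeff S (g y)) x) :
    evenDeriv j (fun y => f y * g y) x = evenDeriv j f x * g x + f x * evenDeriv j g x := by
  set b := (Pi.basisFun ℝ (Fin q)).ExteriorAlgebra with hb
  have h1 : (fun y => f y * g y) = fun y => ∑ p ∈ (Finset.univ ×ˢ Finset.univ :
      Finset (Finset (Fin q) × Finset (Fin q))),
        (coeff p.1 (f y) * coeff p.2 (g y)) • (b p.1 * b p.2) := by
    ext y
    rw [Finset.sum_product]
    nth_rewrite 1 [← sum_coeff_smul (f y), ← sum_coeff_smul (g y)]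
    rw [Finset.sum_mul_sum]
    simp only [smul_mul_smul_comm, ← hb]
  rw [h1, evenDeriv_sum_smul j _ _ _ fun p _ => (hf p.1).mul (hg p.2), Finset.sum_product]
  conv_rhs => rw [← sum_coeff_smul (f x), ← sum_coeff_smul (g x)]
  rw [evenDeriv, evenDeriv, Finset.sum_mul_sum, Finset.sum_mul_sum, ← Finset.sum_add_distrib]
  refine Finset.sum_congr rfl fun S _ => ?_
  rw [← Finset.sum_add_distrib]
  refine Finset.sum_congr rfl fun T _ => ?_
  rw [smul_mul_smul_comm, smul_mul_smul_comm, ← add_smul, fderiv_fun_mul (hf S) (hg T)]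
  congr 1
  simp only [add_apply, smul_apply, smul_eq_mul]
  ring

theorem evenDeriv_smul_add_const {n q : ℕ} (j : Fin n) {g : (Fin n → ℝ) → ℝ} {x : Fin n → ℝ}
    (hg : DifferentiableAt ℝ g x) (v w : Grassmann q) :
    evenDeriv j (fun y => g y • v + w) x = fderiv ℝ g x (Pi.single j 1) • v := by
  have h := evenDeriv_sum_smul j (Finset.univ : Finset (Fin 2)) ![g, fun _ => 1] ![v, w] (x := x)
    (by intro i _; fin_cases i <;> simp [hg])
  simp only [Fin.sum_univ_two] at h
  simpa using h

/-! ### The odd part of the Euclidean metric -/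

/-- The odd-odd block of the Euclidean metric. -/
def oddMetric (m : ℕ) : Matrix (Fin (2 * m)) (Fin (2 * m)) ℝ :=
  Matrix.of fun i j => ∑ μ : Fin m,
    ((if i = etaIdx μ ∧ j = xiIdx μ then 1 else 0) -
      (if i = xiIdx μ ∧ j = etaIdx μ then 1 else 0))

/-- The odd coordinates come in pairs `ξ^μ, η^μ`. -/
def oddIdxEquiv (m : ℕ) : Fin m × Fin 2 ≃ Fin (2 * m) :=
  finProdFinEquiv.trans (finCongr (mul_comm m 2))

theorem oddIdxEquiv_zero {m : ℕ} (μ : Fin m) : oddIdxEquiv m (μ, 0) = xiIdx μ := by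
  simp [oddIdxEquiv, xiIdx, finProdFinEquiv]

theorem oddIdxEquiv_one {m : ℕ} (μ : Fin m) : oddIdxEquiv m (μ, 1) = etaIdx μ := by
  simp [oddIdxEquiv, etaIdx, finProdFinEquiv, add_comm]

theorem sum_odd {m : ℕ} {A : Type*} [AddCommMonoid A] (f : Fin (2 * m) → A) :
    ∑ j, f j = ∑ μ : Fin m, (f (xiIdx μ) + f (etaIdx μ)) := by
  rw [← (oddIdxEquiv m).sum_comp, Fintype.sum_prod_type]
  refine Finset.sum_congr rfl fun μ _ => ?_
  rw [Fin.sum_univ_two, oddIdxEquiv_zero, oddIdxEquiv_one]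

/-- Grouped into pairs, the odd metric is m copies of a quarter turn. This gives its determinant 1
and its inverse, which is its negative. -/
theorem oddMetric_submatrix (m : ℕ) : (oddMetric m).submatrix (oddIdxEquiv m) (oddIdxEquiv m) =
    Matrix.kroneckerMap (· * ·) (1 : Matrix (Fin m) (Fin m) ℝ) !![0, -1; 1, 0] := by
  ext ⟨μ, a⟩ ⟨ν, b⟩
  rw [Matrix.submatrix_apply, oddMetric, Matrix.of_apply, Matrix.kroneckerMap_apply,
    Matrix.one_apply]
  have h1 := xiIdx_ne_etaIdx (m := m)
  have h2 := fun μ ν => (xiIdx_ne_etaIdx (m := m) μ ν).symm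
  fin_cases a <;> fin_cases b <;>
    simp [oddIdxEquiv_zero, oddIdxEquiv_one, xiIdx_inj, etaIdx_inj, h1, h2, ite_and,
      Finset.sum_ite_eq, eq_comm]

theorem det_oddMetric (m : ℕ) : (oddMetric m).det = 1 := by
  rw [← Matrix.det_submatrix_equiv_self (oddIdxEquiv m), oddMetric_submatrix, Matrix.det_kronecker]
  simp [Matrix.det_fin_two]

theorem oddMetric_mul_neg (m : ℕ) : oddMetric m * (-oddMetric m) = 1 := by
  have h : (oddMetric m * (-oddMetric m)).submatrix (oddIdxEquiv m) (oddIdxEquiv m) = 1 := by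
    rw [← Matrix.submatrix_mul_equiv _ _ _ (oddIdxEquiv m), Matrix.submatrix_neg, Pi.neg_apply, Pi.neg_apply,
      oddMetric_submatrix, mul_neg, ← Matrix.mul_kronecker_mul, one_mul]
    have h2 : (!![0, -1; 1, 0] * !![0, -1; 1, 0] : Matrix (Fin 2) (Fin 2) ℝ) = -1 := by
      ext i j; fin_cases i <;> fin_cases j <;> simp
    rw [h2]
    ext ⟨μ, a⟩ ⟨ν, b⟩
    simp only [Matrix.neg_apply, Matrix.kroneckerMap_apply, Matrix.one_apply, Prod.mk.injEq]
    split_ifs <;> simp_all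
  ext i j
  have := congrFun (congrFun h ((oddIdxEquiv m).symm i)) ((oddIdxEquiv m).symm j)
  simpa [Matrix.one_apply] using this

theorem oddMetric_apply_xi {m : ℕ} (b : Fin (2 * m)) (μ : Fin m) :
    oddMetric m b (xiIdx μ) = if b = etaIdx μ then 1 else 0 := by
  rw [oddMetric, Matrix.of_apply, Finset.sum_eq_single μ]
  · simp [xiIdx_ne_etaIdx]
  · intro ν _ hν; simp [xiIdx_ne_etaIdx, xiIdx_inj, hν.symm]
  · simp

theorem oddMetric_apply_eta {m : ℕ} (b : Fin (2 * m)) (μ : Fin m) :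
    oddMetric m b (etaIdx μ) = -if b = xiIdx μ then 1 else 0 := by
  rw [oddMetric, Matrix.of_apply, Finset.sum_eq_single μ]
  · simp [(xiIdx_ne_etaIdx _ _).symm]
  · intro ν _ hν; simp [(xiIdx_ne_etaIdx _ _).symm, etaIdx_inj, hν.symm]
  · simp

theorem oddDeriv_oddSquare {m : ℕ} (b : Fin (2 * m)) :
    oddDeriv b (oddSquare m) = (2 : ℝ) • ∑ c, oddMetric m b c • theta c := by
  rw [oddSquare, map_smul, map_sum, sum_odd]
  congr 1
  refine Finset.sum_congr rfl fun μ _ => ?_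
  rw [oddMetric_apply_xi, oddMetric_apply_eta, oddDeriv_theta_mul, oddDeriv_theta]
  split_ifs <;> simp [sub_eq_add_neg]

theorem sum_oddMetric_theta_mul_theta (m : ℕ) :
    ∑ b, (∑ c, oddMetric m b c • (theta c : Grassmann (2 * m))) * theta b = -oddSquare m := by
  rw [sum_odd, oddSquare, Finset.smul_sum, ← Finset.sum_neg_distrib]
  refine Finset.sum_congr rfl fun μ _ => ?_
  rw [sum_odd, sum_odd]
  simp only [oddMetric_apply_xi, oddMetric_apply_eta, xiIdx_inj, etaIdx_inj, xiIdx_ne_etaIdx,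
    (xiIdx_ne_etaIdx _ _).symm, if_false, neg_zero, zero_smul, add_zero, zero_add, neg_smul,
    ite_smul, one_smul, Finset.sum_ite_eq, Finset.sum_neg_distrib, Finset.mem_univ, if_true]
  rw [theta_mul_theta_swap (xiIdx μ), two_smul, neg_mul, neg_add]

/-! ### The induced metric in a hemisphere chart -/

section HemisphereChart

variable {n m : ℕ} {R : ℝ} {i : Fin (n + 1)} {ε : ℤˣ} {Φ : SuperMap n (2 * m) (n + 1) (2 * m)}

theorem IsHemisphereChart.even_coord (hΦ : IsHemisphereChart R i ε Φ) {y : Fin n → ℝ}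
    (hy : y ∈ Φ.domain) : Φ.coord (Sum.inl i) y ∈ parityPart (2 * m) 0 := by
  have := hΦ.domain_eq
  simpa [coordParity] using Φ.parity (Sum.inl i) y hy

theorem IsHemisphereChart.coord_sq (hΦ : IsHemisphereChart R i ε Φ) {y : Fin n → ℝ}
    (hy : y ∈ Φ.domain) : Φ.coord (Sum.inl i) y ^ 2 =
      algebraMap ℝ (Grassmann (2 * m)) (R ^ 2 - ∑ j, y j ^ 2) + oddSquare m := by
  have h := hΦ.sphere_eq y hy
  have h1 : ∑ μ : Fin m, Φ.coord (Sum.inr (xiIdx μ)) y * Φ.coord (Sum.inr (etaIdx μ)) y =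
      -∑ μ : Fin m, theta (etaIdx μ) * theta (xiIdx μ) := by
    rw [← Finset.sum_neg_distrib]
    refine Finset.sum_congr rfl fun μ _ => ?_
    rw [hΦ.coord_odd y hy, hΦ.coord_odd y hy, theta_mul_theta_swap]
  rw [SuperMap.scalarSquare, h1, smul_neg, Fin.sum_univ_succAbove _ i] at h
  simp only [hΦ.coord_even y hy, ← map_pow] at h
  rw [← map_sum, ← sub_eq_add_neg, sub_eq_iff_eq_add, ← eq_sub_iff_add_eq] at h
  rw [h, map_sub, oddSquare]
  abel

theorem IsHemisphereChart.sub_pos (hΦ : IsHemisphereChart R i ε Φ) {y : Fin n → ℝ}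
    (hy : y ∈ Φ.domain) : 0 < R ^ 2 - ∑ j, y j ^ 2 := by
  rw [hΦ.domain_eq] at hy
  exact _root_.sub_pos.mpr hy

theorem IsHemisphereChart.isUnit_coord (hΦ : IsHemisphereChart R i ε Φ) {y : Fin n → ℝ}
    (hy : y ∈ Φ.domain) : IsUnit (Φ.coord (Sum.inl i) y) :=
  isUnit_of_body_ne_zero (hΦ.even_coord hy) fun h => by
    have := hΦ.sign y hy
    rw [h, mul_zero] at this
    exact this.false

/-- Obtained by differentiating X² = R² − ∑ y_j² + ν. As X is central, the product rule gives 2 X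
∂_j X. -/
theorem IsHemisphereChart.coord_mul_evenDeriv (hΦ : IsHemisphereChart R i ε Φ) {y : Fin n → ℝ}
    (hy : y ∈ Φ.domain) (j : Fin n) :
    Φ.coord (Sum.inl i) y * evenDeriv j (Φ.coord (Sum.inl i)) y =
      -algebraMap ℝ (Grassmann (2 * m)) (y j) := by
  have hnhds := Φ.isOpen_domain.mem_nhds hy
  have hd : ∀ S, DifferentiableAt ℝ (fun z => coeff S (Φ.coord (Sum.inl i) z)) y := fun S =>
    ((Φ.smooth (Sum.inl i) S).contDiffAt hnhds).differentiableAt (by simp)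
  have h1 := evenDeriv_mul j hd hd
  have h2 : (fun z => Φ.coord (Sum.inl i) z * Φ.coord (Sum.inl i) z) =ᶠ[nhds y]
      fun z => (R ^ 2 - ∑ j, z j ^ 2) • (1 : Grassmann (2 * m)) + oddSquare m := by
    filter_upwards [hnhds] with z hz
    rw [← pow_two, hΦ.coord_sq hz, Algebra.algebraMap_eq_smul_one]
  have hg : HasFDerivAt (fun z : Fin n → ℝ => R ^ 2 - ∑ j, z j ^ 2)
      (-∑ k, (2 * y k) • (ContinuousLinearMap.proj k : (Fin n → ℝ) →L[ℝ] ℝ)) y := by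
    refine HasFDerivAt.const_sub (HasFDerivAt.fun_sum fun k _ => ?_) _
    simpa using (hasFDerivAt_apply (𝕜 := ℝ) k y).pow 2
  have h3 : fderiv ℝ (fun z : Fin n → ℝ => R ^ 2 - ∑ j, z j ^ 2) y (Pi.single j 1) =
      -(2 * y j) := by
    rw [hg.fderiv]
    simp [sum_apply, Pi.single_apply]
  rw [evenDeriv_congr j h2, evenDeriv_smul_add_const j hg.differentiableAt, h3,
    ← (even_commute (hΦ.even_coord hy) _).eq, ← two_smul ℝ, neg_smul, mul_smul, ← smul_neg] at h1
  rw [Algebra.algebraMap_eq_smul_one]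
  exact (smul_right_injective _ (two_ne_zero (α := ℝ)) h1).symm

theorem IsHemisphereChart.coord_mul_oddDeriv (hΦ : IsHemisphereChart R i ε Φ) {y : Fin n → ℝ}
    (hy : y ∈ Φ.domain) (b : Fin (2 * m)) :
    Φ.coord (Sum.inl i) y * oddDeriv b (Φ.coord (Sum.inl i) y) =
      ∑ c, oddMetric m b c • theta c := by
  have h := congrArg (oddDeriv b) (hΦ.coord_sq hy)
  rw [pow_two, oddDeriv_even_mul _ (hΦ.even_coord hy), ← (even_commute (hΦ.even_coord hy) _).eq,
    ← two_smul ℝ, map_add, oddDeriv_algebraMap, zero_add, oddDeriv_oddSquare] at h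
  exact smul_right_injective _ (two_ne_zero (α := ℝ)) h

theorem superDeriv_inl_of_eqOn {N q : ℕ} {U : Set (Fin N → ℝ)} (hU : IsOpen U) {y : Fin N → ℝ}
    (hy : y ∈ U) {f : (Fin N → ℝ) → Grassmann q} {c : Grassmann q} (hf : ∀ z ∈ U, f z = c)
    (j : Fin N) : superDeriv (Sum.inl j) f y = 0 := by
  have h : f =ᶠ[nhds y] fun z => (0 : ℝ) • (1 : Grassmann q) + c := by
    filter_upwards [hU.mem_nhds hy] with z hz
    rw [hf z hz, zero_smul, zero_add]
  rw [superDeriv, Sum.elim_inl, evenDeriv_congr j h,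
    evenDeriv_smul_add_const j (differentiableAt_const _)]
  simp

theorem IsHemisphereChart.superDeriv_succAbove (hΦ : IsHemisphereChart R i ε Φ) {y : Fin n → ℝ}
    (hy : y ∈ Φ.domain) (k : Fin n) (a : Fin n ⊕ Fin (2 * m)) :
    superDeriv a (Φ.coord (Sum.inl (i.succAbove k))) y = if a = Sum.inl k then 1 else 0 := by
  rcases a with j | b
  · have h : Φ.coord (Sum.inl (i.succAbove k)) =ᶠ[nhds y]
        fun z => z k • (1 : Grassmann (2 * m)) + 0 := by
      filter_upwards [Φ.isOpen_domain.mem_nhds hy] with z hz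
      rw [hΦ.coord_even z hz, Algebra.algebraMap_eq_smul_one, add_zero]
    rw [superDeriv, Sum.elim_inl, evenDeriv_congr j h,
      evenDeriv_smul_add_const j (differentiableAt_apply k y), (hasFDerivAt_apply k y).fderiv]
    simp [Pi.single_apply, eq_comm]
  · rw [superDeriv, Sum.elim_inr, hΦ.coord_even y hy, oddDeriv_algebraMap]
    simp

theorem IsHemisphereChart.superDeriv_odd (hΦ : IsHemisphereChart R i ε Φ) {y : Fin n → ℝ}
    (hy : y ∈ Φ.domain) (c : Fin (2 * m)) (a : Fin n ⊕ Fin (2 * m)) :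
    superDeriv a (Φ.coord (Sum.inr c)) y = if a = Sum.inr c then 1 else 0 := by
  rcases a with j | b
  · rw [superDeriv_inl_of_eqOn Φ.isOpen_domain hy fun z hz => hΦ.coord_odd z hz c]
    simp
  · rw [superDeriv, Sum.elim_inr, hΦ.coord_odd y hy, oddDeriv_theta]
    simp

/-- All coordinates other than X are chart coordinates with Kronecker deltas as derivatives, so they
contribute the constant metric and X contributes the tensor square of dX. The sign (−1)^{1+|b|} is
+1 on the odd-odd block, the only place where its delta factors survive. -/
theorem IsHemisphereChart.inducedMetric_eq (hΦ : IsHemisphereChart R i ε Φ) {y : Fin n → ℝ}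
    (hy : y ∈ Φ.domain) {p : Fin n → Grassmann (2 * m)} {r : Fin (2 * m) → Grassmann (2 * m)}
    (hp : ∀ j, p j = evenDeriv j (Φ.coord (Sum.inl i)) y)
    (hr : ∀ b, r b = oddDeriv b (Φ.coord (Sum.inl i) y)) :
    Φ.inducedMetric (euclideanMetric (n + 1) m) y =
      Matrix.fromBlocks (1 + Matrix.vecMulVec p p) (Matrix.vecMulVec p r) (Matrix.vecMulVec r p)
        ((oddMetric m).map (algebraMap ℝ (Grassmann (2 * m))) + Matrix.vecMulVec r r) := by
  have hv : ∀ a, superDeriv a (Φ.coord (Sum.inl i)) y = Sum.elim p r a := by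
    rintro (j | b)
    · exact (hp j).symm
    · exact (hr b).symm
  have hG : ∀ c d, euclideanMetric (n + 1) m (Sum.inr c) (Sum.inr d) = oddMetric m c d :=
    fun c d => rfl
  have key : ∀ a b, Φ.inducedMetric (euclideanMetric (n + 1) m) y a b =
      Sum.elim p r a * Sum.elim p r b +
      ∑ k : Fin n, ((if a = Sum.inl k then 1 else 0) * (if b = Sum.inl k then 1 else 0)) +
      ∑ c, ∑ d, ((-1 : ℝ) ^ (1 + coordParity b) * oddMetric m c d) •
        ((if a = Sum.inr c then 1 else 0) * (if b = Sum.inr d then 1 else 0)) := by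
    intro a b
    rw [SuperMap.inducedMetric, Matrix.of_apply, Fintype.sum_sum_type]
    simp only [Fintype.sum_sum_type, hG, hΦ.superDeriv_odd hy]
    have h1 : ∀ k l, euclideanMetric (n + 1) m (Sum.inl k) (Sum.inl l) =
      if k = l then 1 else 0 := fun k l => Matrix.one_apply
    have h2 : ∀ k d, euclideanMetric (n + 1) m (Sum.inl k) (Sum.inr d) = 0 := fun k d => rfl
    have h3 : ∀ k d, euclideanMetric (n + 1) m (Sum.inr d) (Sum.inl k) = 0 := fun k d => rfl
    simp only [h1, h2, h3, coordParity, Sum.elim_inl, Sum.elim_inr, mul_zero, zero_smul,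
      Finset.sum_const_zero, add_zero, zero_add, zero_mul, pow_zero, one_mul, ite_smul, one_smul,
      Finset.sum_ite_eq, Finset.mem_univ, if_true]
    rw [Fin.sum_univ_succAbove _ i]
    simp only [hv, hΦ.superDeriv_succAbove hy]
  ext a b
  rw [key]
  rcases a with a | a <;> rcases b with b | b
  · simp [Matrix.one_apply, Matrix.vecMulVec_apply, add_comm]
  · simp [Matrix.vecMulVec_apply]
  · simp [Matrix.vecMulVec_apply]
  · simp [Matrix.vecMulVec_apply, coordParity, add_comm, Algebra.algebraMap_eq_smul_one]

/-- With p = −y/X and r = Jθ/X, J the odd metric, the Berezinian is 1 + (∑ y_j² − ν)/X². Multiplying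
by X² = R² − ∑ y_j² + ν leaves R². -/
theorem IsHemisphereChart.coord_sq_mul_berezinian (hΦ : IsHemisphereChart R i ε Φ)
    {y : Fin n → ℝ} (hy : y ∈ Φ.domain) :
    Φ.coord (Sum.inl i) y ^ 2 * berezinian (Φ.inducedMetric (euclideanMetric (n + 1) m) y) =
      algebraMap ℝ (Grassmann (2 * m)) (R ^ 2) := by
  set X := Φ.coord (Sum.inl i) y with hX
  obtain ⟨U, hU⟩ := hΦ.isUnit_coord hy
  have hXc : ∀ x, Commute X x := even_commute (hΦ.even_coord hy)
  have hYc : ∀ x, Commute (↑U⁻¹ : Grassmann (2 * m)) x := fun x =>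
    Commute.units_inv_left (by rw [hU]; exact hXc x)
  set Y : Grassmann (2 * m) := ↑U⁻¹ with hY
  have hXY : X * Y = 1 := by rw [hX, ← hU, hY, Units.mul_inv]
  have hYX : Y * X = 1 := by rw [← (hXc Y).eq, hXY]
  set p : Fin n → Grassmann (2 * m) := fun j => evenDeriv j (Φ.coord (Sum.inl i)) y with hp
  set r : Fin (2 * m) → Grassmann (2 * m) := fun b => oddDeriv b X with hr
  have hpY : ∀ j, p j = Y * (-algebraMap ℝ (Grassmann (2 * m)) (y j)) := fun j => by
    rw [← hΦ.coord_mul_evenDeriv hy j, ← mul_assoc, hYX, one_mul]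
  have hrY : ∀ b, r b = Y * ∑ c, oddMetric m b c • theta c := fun b => by
    rw [← hΦ.coord_mul_oddDeriv hy b, ← mul_assoc, hYX, one_mul]
  have hYY : ∀ a b : Grassmann (2 * m), (Y * a) * (Y * b) = Y * Y * (a * b) := fun a b => by
    rw [mul_assoc, ← mul_assoc a, ← (hYc a).eq, mul_assoc, mul_assoc]
  have hww : ∀ b b', (∑ c, oddMetric m b c • (theta c : Grassmann (2 * m))) *
      (∑ c, oddMetric m b' c • theta c) = -((∑ c, oddMetric m b' c • theta c) *
        (∑ c, oddMetric m b c • theta c)) := fun b b' => by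
    rw [Finset.sum_mul_sum, Finset.sum_mul_sum, Finset.sum_comm, ← Finset.sum_neg_distrib]
    refine Finset.sum_congr rfl fun c _ => ?_
    rw [← Finset.sum_neg_distrib]
    refine Finset.sum_congr rfl fun d _ => ?_
    rw [smul_mul_smul_comm, smul_mul_smul_comm, theta_mul_theta_swap, smul_neg,
      mul_comm (oddMetric m b d)]
  have hwc : ∀ b b' x, Commute ((∑ c, oddMetric m b c • (theta c : Grassmann (2 * m))) *
      (∑ c, oddMetric m b' c • theta c)) x := fun b b' x => by
    refine even_commute ?_ x
    rw [Finset.sum_mul_sum]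
    refine sum_mem fun c _ => sum_mem fun d _ => ?_
    rw [smul_mul_smul_comm]
    exact even_smul _ (even_theta_mul_theta c d)
  rw [hΦ.inducedMetric_eq hy (fun _ => rfl) (fun _ => rfl),
    berezinian_add_vecMulVec (oddMetric m) (-oddMetric m) (oddMetric_mul_neg m) (det_oddMetric m)
      p r]
  · have hu : ∀ b, ((-oddMetric m).map (algebraMap ℝ (Grassmann (2 * m))) *ᵥ r) b =
        Y * theta b := by
      intro b
      have h1 : ((-oddMetric m) * oddMetric m) = 1 := mul_eq_one_comm.mp (oddMetric_mul_neg m)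
      have h2 : ∀ c, (algebraMap ℝ (Grassmann (2 * m))) ((-oddMetric m) b c) * r c =
          Y * ∑ d, ((-oddMetric m) b c * oddMetric m c d) • theta d := fun c => by
        rw [hrY, ← mul_assoc, ← (hYc _).eq, mul_assoc, Finset.mul_sum]
        congr 1
        refine Finset.sum_congr rfl fun d _ => ?_
        rw [← Algebra.smul_def, smul_smul]
      rw [Matrix.mulVec, dotProduct]
      simp only [Matrix.map_apply, h2]
      rw [← Finset.mul_sum, Finset.sum_comm]
      congr 1
      simp only [← Finset.sum_smul, ← Matrix.mul_apply, h1, Matrix.one_apply, ite_smul, one_smul,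
        zero_smul, Finset.sum_ite_eq, Finset.mem_univ, if_true]
    have hτ : r ⬝ᵥ ((-oddMetric m).map (algebraMap ℝ (Grassmann (2 * m))) *ᵥ r) =
        Y * Y * (-oddSquare m) := by
      rw [dotProduct, ← sum_oddMetric_theta_mul_theta, Finset.mul_sum]
      refine Finset.sum_congr rfl fun b _ => ?_
      rw [hu, hrY, hYY]
    have hpp : p ⬝ᵥ p = Y * Y * algebraMap ℝ (Grassmann (2 * m)) (∑ j, y j ^ 2) := by
      rw [dotProduct, map_sum, Finset.mul_sum]
      refine Finset.sum_congr rfl fun j _ => ?_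
      rw [hpY, hYY, neg_mul_neg, ← map_mul, pow_two]
    have hXXYY : ∀ w, X ^ 2 * (Y * Y * w) = w := fun w => by
      rw [← mul_assoc, pow_two, mul_assoc X X, ← mul_assoc X Y, hXY, one_mul, hXY, one_mul]
    rw [hτ, hpp, mul_add, mul_add, mul_one, hXXYY, hXXYY, hΦ.coord_sq hy, map_sub]
    abel
  · intro j x
    rw [hpY]
    exact (hYc x).mul_left (even_commute (neg_mem (even_algebraMap _)) x)
  · intro b b'
    rw [hrY, hrY, hYY, hYY, hww, mul_neg]
  · intro b b' x
    rw [hrY, hrY, hYY]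
    exact ((hYc x).mul_left (hYc x)).mul_left (hwc b b' x)

end HemisphereChart

/-! ### The integrand in a hemisphere chart -/

theorem iteratedDeriv_comp_line {N : ℕ} {f : (Fin N → ℝ) → ℝ} (hf : ContDiff ℝ ∞ f)
    (b v : Fin N → ℝ) (k : ℕ) (t : ℝ) :
    iteratedDeriv k (fun s : ℝ => f (b + s • v)) t =
      iteratedFDeriv ℝ k f (b + t • v) fun _ => v := by
  set g : (Fin N → ℝ) → ℝ := fun u => f (b + u) with hg
  have hgs : ContDiff ℝ ∞ g := hf.comp (contDiff_const.add contDiff_id)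
  have h1 : (fun s : ℝ => f (b + s • v)) = g ∘ (ContinuousLinearMap.toSpanSingleton ℝ v) := by
    ext s; simp [hg]
  rw [iteratedDeriv_eq_iteratedFDeriv, h1, ContinuousLinearMap.iteratedFDeriv_comp_right _ hgs t
    (by exact_mod_cast le_top), hg, iteratedFDeriv_comp_add_left]
  simp

theorem insertNth_eq_add {n : ℕ} (i : Fin (n + 1)) (t : ℝ) (y : Fin n → ℝ) :
    (i.insertNth t y : Fin (n + 1) → ℝ) = i.insertNth 0 y + t • Pi.single i (1 : ℝ) := by
  ext A
  refine i.succAboveCases ?_ (fun j => ?_) A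
  · simp
  · simp

/-- If all but one of the arguments are real numbers, Taylor's formula in several variables
reduces to the one in a single variable. -/
theorem evalSmoothMulti_eq_evalSmooth {q n : ℕ} (i : Fin (n + 1)) {f : (Fin (n + 1) → ℝ) → ℝ}
    (hf : ContDiff ℝ ∞ f) {c : Fin (n + 1) → Grassmann q} {y : Fin n → ℝ}
    (hc : ∀ j, c (i.succAbove j) = algebraMap ℝ (Grassmann q) (y j)) :
    evalSmoothMulti f c = evalSmooth (fun t => f (i.insertNth t y)) (c i) := by
  have hb : (fun A => body (c A)) = i.insertNth (body (c i)) y := by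
    ext A
    refine i.succAboveCases ?_ (fun j => ?_) A
    · simp
    · simp [hc, body_algebraMap]
  have hsoul : ∀ A, A ≠ i → soul (c A) = 0 := by
    intro A hA
    obtain ⟨j, rfl⟩ := Fin.exists_succAbove_eq hA
    rw [hc, soul, body_algebraMap, sub_self]
  rw [evalSmoothMulti, evalSmooth]
  refine Finset.sum_congr rfl fun k _ => ?_
  -- Any other multi-index contains the soul of a real argument, which is zero.
  rw [Finset.sum_eq_single (fun _ => i), List.ofFn_const, List.prod_replicate, smul_smul, hb,
    insertNth_eq_add i (body (c i)), ← iteratedDeriv_comp_line hf]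
  · congr 1
    rw [div_eq_inv_mul]
    simp only [← insertNth_eq_add]
  · intro idx _ hidx
    obtain ⟨l, hl⟩ := Function.ne_iff.mp hidx
    rw [List.prod_eq_zero, smul_zero]
    rw [List.mem_ofFn]
    exact ⟨l, hsoul _ hl⟩
  · simp

theorem sign_mul_self (ε : ℤˣ) : ((ε : ℤ) : ℝ) * ((ε : ℤ) : ℝ) = 1 := by
  rcases Int.units_eq_one_or ε with rfl | rfl <;> simp

theorem contDiffAt_sign_mul_sqrt (e : ℝ) {a : ℝ} (ha : 0 < a) :
    ContDiffAt ℝ ∞ (fun w => e * √w) a :=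
  contDiffAt_const.mul (Real.contDiffAt_sqrt ha.ne')

section HemisphereChart

variable {n m : ℕ} {R : ℝ} {i : Fin (n + 1)} {ε : ℤˣ} {Φ : SuperMap n (2 * m) (n + 1) (2 * m)}

theorem taylorEval_sqrt_sq (m : ℕ) (ε : ℤˣ) {a : ℝ} (ha : 0 < a) :
    taylorEval (2 * m + 1) (fun w => ((ε : ℤ) : ℝ) * √w) a (oddSquare m) ^ 2 =
      algebraMap ℝ (Grassmann (2 * m)) a + oddSquare m := by
  have hz := oddSquare_pow_eq_zero m
  rw [← taylorEval_pow (contDiffAt_sign_mul_sqrt _ ha) hz, ← taylorEval_id hz]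
  refine taylorEval_congr ?_ _
  filter_upwards [lt_mem_nhds ha] with w hw
  rw [Pi.pow_apply, mul_pow, Real.sq_sqrt hw.le, pow_two, sign_mul_self, one_mul]

/-- Both sides are even square roots of w + ν whose bodies have the same sign. -/
theorem IsHemisphereChart.coord_eq (hΦ : IsHemisphereChart R i ε Φ) {y : Fin n → ℝ}
    (hy : y ∈ Φ.domain) : Φ.coord (Sum.inl i) y =
      taylorEval (2 * m + 1) (fun w => ((ε : ℤ) : ℝ) * √w) (R ^ 2 - ∑ j, y j ^ 2)
        (oddSquare m) := by
  have ha := hΦ.sub_pos hy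
  refine even_eq_of_sq_eq (hΦ.even_coord hy) (even_taylorEval _ _ _ (even_oddSquare m)) ?_ ?_
  · rw [hΦ.coord_sq hy, taylorEval_sqrt_sq m ε ha]
  · rw [body_taylorEval _ _ (body_oddSquare m)]
    intro h
    have h1 := hΦ.sign y hy
    have h2 : ((ε : ℤ) : ℝ) * body (Φ.coord (Sum.inl i) y) + √(R ^ 2 - ∑ j, y j ^ 2) = 0 := by
      have h3 := congrArg (((ε : ℤ) : ℝ) * ·) h
      simp only [mul_add, ← mul_assoc, sign_mul_self, mul_zero, one_mul] at h3
      exact h3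
    have := Real.sqrt_nonneg (R ^ 2 - ∑ j, y j ^ 2)
    linarith

theorem IsHemisphereChart.volumeDensity_eq (hΦ : IsHemisphereChart R i ε Φ) (hR : 0 < R)
    {y : Fin n → ℝ} (hy : y ∈ Φ.domain) :
    Φ.volumeDensity (euclideanMetric (n + 1) m) y =
      taylorEval (2 * m + 1) (fun w => R / √w) (R ^ 2 - ∑ j, y j ^ 2) (oddSquare m) := by
  have ha := hΦ.sub_pos hy
  set a := R ^ 2 - ∑ j, y j ^ 2 with ha_def
  have hz := oddSquare_pow_eq_zero m
  have hinv : ContDiffAt ℝ ∞ (fun w : ℝ => R ^ 2 / w) a :=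
    contDiffAt_const.div contDiffAt_id ha.ne'
  have hB : berezinian (Φ.inducedMetric (euclideanMetric (n + 1) m) y) =
      taylorEval (2 * m + 1) (fun w => R ^ 2 / w) a (oddSquare m) := by
    have h1 := hΦ.coord_sq_mul_berezinian hy
    have h2 : Φ.coord (Sum.inl i) y ^ 2 *
        taylorEval (2 * m + 1) (fun w => R ^ 2 / w) a (oddSquare m) =
          algebraMap ℝ (Grassmann (2 * m)) (R ^ 2) := by
      rw [hΦ.coord_sq hy, ← taylorEval_id hz, ← taylorEval_mul (f := fun t => t)
        contDiffAt_id hinv hz, ← taylorEval_const (R ^ 2) hz]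
      refine taylorEval_congr ?_ _
      filter_upwards [lt_mem_nhds ha] with w hw
      rw [Pi.mul_apply, mul_div_cancel₀ _ hw.ne']
    exact ((hΦ.isUnit_coord hy).pow 2).mul_left_cancel (h1.trans h2.symm)
  rw [SuperMap.volumeDensity, hB, evalSmooth_taylorEval hinv
    (Real.contDiffAt_sqrt (by positivity)) hz (body_oddSquare m)]
  refine taylorEval_congr ?_ _
  filter_upwards [lt_mem_nhds ha] with w hw
  rw [Function.comp_apply, Real.sqrt_div (sq_nonneg R), Real.sqrt_sq hR.le]

theorem contDiff_insertNth {n : ℕ} (i : Fin (n + 1)) (y : Fin n → ℝ) :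
    ContDiff ℝ ∞ fun t : ℝ => (i.insertNth t y : Fin (n + 1) → ℝ) := by
  rw [funext fun t => insertNth_eq_add i t y]
  exact contDiff_const.add (contDiff_id.smul contDiff_const)

theorem IsHemisphereChart.pullback_eq (hΦ : IsHemisphereChart R i ε Φ)
    {y : Fin n → ℝ} (hy : y ∈ Φ.domain) {ρ : (Fin (n + 1) → ℝ) → ℝ} (hρ : ContDiff ℝ ∞ ρ) :
    Φ.pullback ρ y = taylorEval (2 * m + 1)
      (fun w => ρ (i.insertNth (((ε : ℤ) : ℝ) * √w) y)) (R ^ 2 - ∑ j, y j ^ 2)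
        (oddSquare m) := by
  rw [SuperMap.pullback, evalSmoothMulti_eq_evalSmooth i hρ (hΦ.coord_even y hy), hΦ.coord_eq hy,
    evalSmooth_taylorEval (g := fun t => ρ (i.insertNth t y)) (contDiffAt_sign_mul_sqrt _ (hΦ.sub_pos hy))
      (hρ.comp (contDiff_insertNth i y)).contDiffAt (oddSquare_pow_eq_zero m) (body_oddSquare m)]
  rfl

/-- The integrand in a hemisphere chart is an iterated derivative of the classical integrand. -/
theorem IsHemisphereChart.integrand_eq (hΦ : IsHemisphereChart R i ε Φ) (hR : 0 < R)
    {y : Fin n → ℝ} (hy : y ∈ Φ.domain) {ρ : (Fin (n + 1) → ℝ) → ℝ} (hρ : ContDiff ℝ ∞ ρ) :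
    Φ.integrand (euclideanMetric (n + 1) m) ρ y = 2 ^ m * R *
      iteratedDeriv m (fun w => ρ (i.insertNth (((ε : ℤ) : ℝ) * √w) y) / √w)
        (R ^ 2 - ∑ j, y j ^ 2) := by
  have ha := hΦ.sub_pos hy
  have h1 : ContDiffAt ℝ ∞ (fun w => ρ (i.insertNth (((ε : ℤ) : ℝ) * √w) y))
      (R ^ 2 - ∑ j, y j ^ 2) :=
    (hρ.comp (contDiff_insertNth i y)).contDiffAt.comp _ (contDiffAt_sign_mul_sqrt _ ha)
  have h2 : ContDiffAt ℝ ∞ (fun w => R / √w) (R ^ 2 - ∑ j, y j ^ 2) :=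
    contDiffAt_const.div (Real.contDiffAt_sqrt ha.ne') (Real.sqrt_pos.mpr ha).ne'
  rw [SuperMap.integrand, hΦ.pullback_eq hy hρ, hΦ.volumeDensity_eq hR hy,
    ← taylorEval_mul h1 h2 (oddSquare_pow_eq_zero m), oddBerezin_taylorEval_oddSquare, mul_assoc,
    ← iteratedDeriv_const_mul_field R]
  congr 2
  funext w
  simp only [Pi.mul_apply]
  ring

end HemisphereChart

/-! ### Existence of the hemisphere atlas and of partitions of unity -/

theorem superSmoothOn_const {n q : ℕ} (a : Grassmann q) (U : Set (Fin n → ℝ)) :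
    SuperSmoothOn (fun _ => a) U := fun _ => contDiffOn_const

theorem superSmoothOn_algebraMap {n q : ℕ} {g : (Fin n → ℝ) → ℝ} {U : Set (Fin n → ℝ)}
    (hg : ContDiffOn ℝ ∞ g U) : SuperSmoothOn (fun y => algebraMap ℝ (Grassmann q) (g y)) U := by
  intro S
  simp only [Algebra.algebraMap_eq_smul_one, coeff_smul]
  exact hg.mul contDiffOn_const

theorem superSmoothOn_taylorEval {n q N : ℕ} {f : ℝ → ℝ} {g : (Fin n → ℝ) → ℝ}
    {U : Set (Fin n → ℝ)} (hg : ContDiffOn ℝ ∞ g U) (hf : ∀ y ∈ U, ContDiffAt ℝ ∞ f (g y))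
    (z : Grassmann q) : SuperSmoothOn (fun y => taylorEval N f (g y) z) U := by
  intro S
  simp only [taylorEval, coeff_sum, coeff_smul]
  refine ContDiffOn.sum fun k _ => ContDiffOn.mul (ContDiffOn.div_const ?_ _) contDiffOn_const
  intro y hy
  exact (contDiffAt_iteratedDeriv (hf y hy) k).comp_contDiffWithinAt y (hg y hy)

/-- The chart of the supersphere over the hemisphere `ε x^i > 0`. -/
def hemisphereChart (n m : ℕ) (R : ℝ) (i : Fin (n + 1)) (ε : ℤˣ) :
    SuperMap n (2 * m) (n + 1) (2 * m) where
  domain := {y | ∑ j, y j ^ 2 < R ^ 2}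
  isOpen_domain := isOpen_lt (by fun_prop) continuous_const
  coord := Sum.elim (fun A y => i.insertNth (α := fun _ => Grassmann (2 * m))
      (taylorEval (2 * m + 1) (fun w => ((ε : ℤ) : ℝ) * √w) (R ^ 2 - ∑ j, y j ^ 2) (oddSquare m))
      (fun j => algebraMap ℝ (Grassmann (2 * m)) (y j)) A) (fun j _ => theta j)
  smooth := by
    rintro (A | j)
    · refine i.succAboveCases ?_ (fun j => ?_) A
      · simp only [Sum.elim_inl, Fin.insertNth_apply_same]
        exact superSmoothOn_taylorEval (by fun_prop) (fun y hy =>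
          contDiffAt_sign_mul_sqrt _ (sub_pos.mpr hy)) _
      · simp only [Sum.elim_inl, Fin.insertNth_apply_succAbove]
        exact superSmoothOn_algebraMap (by fun_prop)
    · exact superSmoothOn_const _ _
  parity := by
    rintro (A | j) y _
    · simp only [coordParity, Sum.elim_inl, Nat.cast_zero]
      refine i.succAboveCases ?_ (fun j => ?_) A
      · simp only [Fin.insertNth_apply_same]
        exact even_taylorEval _ _ _ (even_oddSquare m)
      · simp only [Fin.insertNth_apply_succAbove]
        exact even_algebraMap _
    · simp only [coordParity, Sum.elim_inr, Nat.cast_one]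
      exact odd_theta j

theorem isHemisphereChart_hemisphereChart (n m : ℕ) (R : ℝ) (i : Fin (n + 1)) (ε : ℤˣ) :
    IsHemisphereChart R i ε (hemisphereChart n m R i ε) where
  domain_eq := rfl
  coord_odd _ _ _ := rfl
  coord_even y _ j := by simp [hemisphereChart]
  sign y hy := by
    have ha : 0 < R ^ 2 - ∑ j, y j ^ 2 := sub_pos.mpr hy
    simp only [hemisphereChart, Sum.elim_inl, Fin.insertNth_apply_same]
    rw [body_taylorEval _ _ (body_oddSquare m), ← mul_assoc, sign_mul_self, one_mul]
    exact Real.sqrt_pos.mpr ha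
  sphere_eq y hy := by
    have ha : 0 < R ^ 2 - ∑ j, y j ^ 2 := sub_pos.mpr hy
    rw [SuperMap.scalarSquare, Fin.sum_univ_succAbove _ i]
    simp only [hemisphereChart, Sum.elim_inl, Sum.elim_inr, Fin.insertNth_apply_same,
      Fin.insertNth_apply_succAbove]
    have h1 : ∑ μ : Fin m, (theta (xiIdx μ) * theta (etaIdx μ) : Grassmann (2 * m)) =
        -∑ μ : Fin m, theta (etaIdx μ) * theta (xiIdx μ) := by
      rw [← Finset.sum_neg_distrib]
      exact Finset.sum_congr rfl fun μ _ => theta_mul_theta_swap _ _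
    rw [taylorEval_sqrt_sq m ε ha, h1, smul_neg, ← oddSquare, map_sub, map_sum]
    simp only [map_pow]
    abel

theorem exists_isHemispherePartition (n : ℕ) {R : ℝ} (hR : 0 < R) :
    ∃ ρ : Fin (n + 1) × ℤˣ → (Fin (n + 1) → ℝ) → ℝ, IsHemispherePartition R ρ := by
  -- If all |x_i| ≤ δ, then |x|² ≤ (n+1)δ² = R²/(4(n+1)) < R²/2. So some `f α` is positive wherever
  -- |x|² ≥ R²/2, while `g` is positive on the rest and zero near the sphere.
  set δ : ℝ := R / (2 * (n + 1)) with hδ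
  have hδ0 : 0 < δ := by positivity
  let f : Fin (n + 1) × ℤˣ → (Fin (n + 1) → ℝ) → ℝ := fun α x =>
    Real.smoothTransition (((α.2 : ℤ) : ℝ) * x α.1 - δ)
  let g : (Fin (n + 1) → ℝ) → ℝ := fun x => Real.smoothTransition (R ^ 2 / 2 - ∑ i, x i ^ 2)
  have hf : ∀ α, ContDiff ℝ ∞ (f α) := fun α =>
    Real.smoothTransition.contDiff.comp (by fun_prop)
  have hg : ContDiff ℝ ∞ g := Real.smoothTransition.contDiff.comp (by fun_prop)
  have hf0 : ∀ α x, 0 ≤ f α x := fun α x => Real.smoothTransition.nonneg _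
  have hg0 : ∀ x, 0 ≤ g x := fun x => Real.smoothTransition.nonneg _
  have hD : ∀ x, 0 < ∑ α, f α x + g x := by
    intro x
    by_cases hx : ∑ i, x i ^ 2 < R ^ 2 / 2
    · exact add_pos_of_nonneg_of_pos (Finset.sum_nonneg fun α _ => hf0 α x)
        (Real.smoothTransition.pos_of_pos (by linarith))
    · refine add_pos_of_pos_of_nonneg ?_ (hg0 x)
      have h1 : ∃ i, δ < |x i| := by
        by_contra! h
        apply hx
        have h2 : ∑ i, x i ^ 2 ≤ ∑ _i : Fin (n + 1), δ ^ 2 := Finset.sum_le_sum fun i _ => by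
          rw [← sq_abs]
          exact pow_le_pow_left₀ (abs_nonneg _) (h i) 2
        refine h2.trans_lt ?_
        rw [Finset.sum_const, Finset.card_univ, Fintype.card_fin, nsmul_eq_mul, hδ, div_pow]
        push_cast
        rw [mul_div_assoc', div_lt_div_iff₀ (by positivity) (by norm_num)]
        have : 0 < R ^ 2 := by positivity
        have hn : (0 : ℝ) ≤ n := n.cast_nonneg
        nlinarith [mul_pos this (by positivity : (0 : ℝ) < (n : ℝ) + 1),
          mul_nonneg this.le (mul_nonneg hn (by positivity : (0 : ℝ) ≤ (n : ℝ) + 1))]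
      obtain ⟨i, hi⟩ := h1
      have h2 : ∃ ε : ℤˣ, δ < ((ε : ℤ) : ℝ) * x i := by
        rcases lt_abs.mp hi with h | h
        · exact ⟨1, by simpa using h⟩
        · exact ⟨-1, by simpa using h⟩
      obtain ⟨ε, hε⟩ := h2
      exact Finset.sum_pos' (fun α _ => hf0 α x) ⟨(i, ε), Finset.mem_univ _,
        Real.smoothTransition.pos_of_pos (sub_pos.mpr hε)⟩
  refine ⟨fun α x => f α x / (∑ β, f β x + g x), ⟨fun α => ?_, fun α x hx _ => ?_, fun x hx => ?_⟩⟩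
  · exact (hf α).div ((ContDiff.sum fun β _ => hf β).add hg) fun x => (hD x).ne'
  · have hclosed : IsClosed {x : Fin (n + 1) → ℝ | δ ≤ ((α.2 : ℤ) : ℝ) * x α.1} :=
      isClosed_le continuous_const (by fun_prop)
    refine hδ0.trans_le (closure_minimal (fun z hz => ?_) hclosed hx)
    by_contra h
    rw [Set.mem_ofPred_eq, not_le] at h
    apply hz
    have : f α z = 0 := Real.smoothTransition.zero_of_nonpos (by linarith)
    simp only [this, zero_div]
  · have hopen : IsOpen {z : Fin (n + 1) → ℝ | R ^ 2 / 2 < ∑ i, z i ^ 2} :=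
      isOpen_lt continuous_const (by fun_prop)
    have hmem : x ∈ {z : Fin (n + 1) → ℝ | R ^ 2 / 2 < ∑ i, z i ^ 2} := by
      rw [Set.mem_ofPred_eq, hx]
      have : 0 < R ^ 2 := by positivity
      linarith
    filter_upwards [hopen.mem_nhds hmem] with z hz
    have hgz : g z = 0 := Real.smoothTransition.zero_of_nonpos (by
      have : R ^ 2 / 2 < ∑ i, z i ^ 2 := hz
      linarith)
    have := hD z
    rw [hgz, add_zero] at this
    simp only [hgz, add_zero]
    rw [← Finset.sum_div, div_self this.ne']

/-! ### Differentiation under the integral sign -/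

section ParametricIntegral

theorem integrable_slice {E : Type*} [NormedAddCommGroup E] [MeasurableSpace E] [BorelSpace E]
    {μ : Measure E} [IsFiniteMeasureOnCompacts μ] {k : ℝ × E → ℝ} (hk : Continuous k)
    (hc : HasCompactSupport k) (u : ℝ) : Integrable (fun y => k (u, y)) μ := by
  refine (hk.comp (by fun_prop : Continuous fun y : E => (u, y))).integrable_of_hasCompactSupport
    (HasCompactSupport.of_support_subset_isCompact (hc.isCompact.image continuous_snd)
      fun y hy => ⟨(u, y), subset_tsupport _ hy, rfl⟩)

variable {E : Type*} [NormedAddCommGroup E] [NormedSpace ℝ E] {k : ℝ × E → ℝ}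

/-- The partial derivative in the real variable. -/
def partialFst (k : ℝ × E → ℝ) (p : ℝ × E) : ℝ := fderiv ℝ k p (1, 0)

theorem contDiff_partialFst (hk : ContDiff ℝ ∞ k) : ContDiff ℝ ∞ (partialFst k) :=
  (hk.fderiv_right (m := ∞) (by simp)).clm_apply contDiff_const

theorem hasCompactSupport_partialFst (hc : HasCompactSupport k) :
    HasCompactSupport (partialFst k) :=
  (hc.fderiv ℝ).mono fun p hp h => hp (by rw [partialFst, h]; rfl)

theorem hasDerivAt_partialFst (hk : ContDiff ℝ ∞ k) (u : ℝ) (y : E) :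
    HasDerivAt (fun u => k (u, y)) (partialFst k (u, y)) u := by
  have h1 := (hk.differentiable (by simp) (u, y)).hasFDerivAt
  exact h1.comp_hasDerivAt u ((hasDerivAt_id u).prodMk (hasDerivAt_const u y))

variable [MeasurableSpace E] [BorelSpace E] {μ : Measure E} [IsFiniteMeasureOnCompacts μ]

theorem hasDerivAt_integral_slice (hk : ContDiff ℝ ∞ k) (hc : HasCompactSupport k) (u : ℝ) :
    HasDerivAt (fun u => ∫ y, k (u, y) ∂μ) (∫ y, partialFst k (u, y) ∂μ) u := by
  have hd := contDiff_partialFst hk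
  have hdc := hasCompactSupport_partialFst hc
  obtain ⟨C, hC⟩ := hdc.exists_bound_of_continuous hd.continuous
  have hK : IsCompact (Prod.snd '' tsupport (partialFst k)) := hdc.isCompact.image continuous_snd
  have hsl : ∀ {g : ℝ × E → ℝ}, Continuous g → HasCompactSupport g → ∀ u,
      Integrable (fun y => g (u, y)) μ := fun hg hgc u => integrable_slice hg hgc u
  refine (hasDerivAt_integral_of_dominated_loc_of_deriv_le
    (bound := (closure (Prod.snd '' tsupport (partialFst k))).indicator fun _ => C)
    (s := Set.univ) (F' := fun v y => partialFst k (v, y)) Filter.univ_mem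
    (Filter.Eventually.of_forall fun v => (hsl hk.continuous hc v).aestronglyMeasurable)
    (hsl hk.continuous hc u) (hsl hd.continuous hdc u).aestronglyMeasurable ?_ ?_ ?_).2
  · refine Filter.Eventually.of_forall fun y v _ => ?_
    by_cases hy : y ∈ closure (Prod.snd '' tsupport (partialFst k))
    · rw [Set.indicator_of_mem hy]
      exact hC _
    · rw [Set.indicator_of_notMem hy]
      have : partialFst k (v, y) = 0 := image_eq_zero_of_notMem_tsupport fun h =>
        hy (subset_closure ⟨(v, y), h, rfl⟩)
      rw [this, norm_zero]
  · exact (integrable_indicator_iff isClosed_closure.measurableSet).mpr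
      (integrableOn_const hK.closure.measure_lt_top.ne)
  · exact Filter.Eventually.of_forall fun y v _ => hasDerivAt_partialFst hk v y

theorem iteratedDeriv_integral_slice (m : ℕ) (hk : ContDiff ℝ ∞ k) (hc : HasCompactSupport k)
    (u : ℝ) : Integrable (fun y => iteratedDeriv m (fun u => k (u, y)) u) μ ∧
      iteratedDeriv m (fun u => ∫ y, k (u, y) ∂μ) u =
        ∫ y, iteratedDeriv m (fun u => k (u, y)) u ∂μ := by
  induction m generalizing k with
  | zero => simpa using integrable_slice hk.continuous hc u
  | succ m ih =>
    have h1 : deriv (fun u => ∫ y, k (u, y) ∂μ) = fun u => ∫ y, partialFst k (u, y) ∂μ :=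
      funext fun v => (hasDerivAt_integral_slice hk hc v).deriv
    have h2 : ∀ y, deriv (fun u => k (u, y)) = fun u => partialFst k (u, y) := fun y =>
      funext fun v => (hasDerivAt_partialFst hk v y).deriv
    simp only [iteratedDeriv_succ', h1, h2]
    exact ih (contDiff_partialFst hk) (hasCompactSupport_partialFst hc)

end ParametricIntegral

/-! ### The classical integrand over a hemisphere -/

/-- The density of `2 σ(x) dx` at the point `x = (y, e √w)` with respect to `dy dw`. -/
def hemisphereKernel {n : ℕ} (i : Fin (n + 1)) (e : ℝ) (σ : (Fin (n + 1) → ℝ) → ℝ)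
    (y : Fin n → ℝ) (w : ℝ) : ℝ := σ (i.insertNth (e * √w) y) / √w

section HemisphereKernel

variable {n : ℕ} {i : Fin (n + 1)} {ε : ℤˣ} {σ : (Fin (n + 1) → ℝ) → ℝ}

/-- The linear form e x_i attains a positive minimum on the compact support. -/
theorem exists_pos_forall_eq_zero (hc : HasCompactSupport σ) {e : ℝ}
    (hpos : ∀ x ∈ tsupport σ, 0 < e * x i) : ∃ δ > 0, ∀ x, e * x i < δ → σ x = 0 := by
  rcases (tsupport σ).eq_empty_or_nonempty with h | h
  · exact ⟨1, one_pos, fun x _ => image_eq_zero_of_notMem_tsupport (by rw [h]; exact id)⟩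
  · obtain ⟨x₀, hx₀, hmin⟩ := hc.isCompact.exists_isMinOn h
      (f := fun x : Fin (n + 1) → ℝ => e * x i) (by fun_prop)
    refine ⟨e * x₀ i, hpos x₀ hx₀, fun x hx => image_eq_zero_of_notMem_tsupport fun hxs => ?_⟩
    exact (hmin hxs).not_gt hx

/-- For w > 0 the square root is smooth and nonzero. Near a point with w ≤ 0, √w stays below the
margin δ of `exists_pos_forall_eq_zero`, so the kernel is locally zero. -/
theorem contDiff_hemisphereKernel (hσ : ContDiff ℝ ∞ σ) (hc : HasCompactSupport σ)
    (hpos : ∀ x ∈ tsupport σ, 0 < ((ε : ℤ) : ℝ) * x i) :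
    ContDiff ℝ ∞ fun p : (Fin n → ℝ) × ℝ => hemisphereKernel i ((ε : ℤ) : ℝ) σ p.1 p.2 := by
  obtain ⟨δ, hδ, h0⟩ := exists_pos_forall_eq_zero hc hpos
  rw [contDiff_iff_contDiffAt]
  rintro ⟨y, w⟩
  rcases lt_or_ge 0 w with hw | hw
  · have hs : ContDiffAt ℝ ∞ (fun p : (Fin n → ℝ) × ℝ => √p.2) (y, w) :=
      (Real.contDiffAt_sqrt hw.ne').comp (y, w) contDiffAt_snd
    refine ContDiffAt.div (hσ.contDiffAt.comp (y, w) ?_) hs (Real.sqrt_pos.mpr hw).ne'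
    rw [contDiffAt_pi]
    intro A
    refine i.succAboveCases ?_ (fun j => ?_) A
    · simp only [Fin.insertNth_apply_same]
      exact contDiffAt_const.mul hs
    · simp only [Fin.insertNth_apply_succAbove]
      fun_prop
  · have hev : (fun p : (Fin n → ℝ) × ℝ => hemisphereKernel i ((ε : ℤ) : ℝ) σ p.1 p.2)
        =ᶠ[nhds (y, w)] fun _ => 0 := by
      have hcont : ContinuousAt (fun p : (Fin n → ℝ) × ℝ => √p.2) (y, w) := by fun_prop
      have hlt : √(y, w).2 < δ := by rwa [Real.sqrt_eq_zero'.mpr hw]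
      filter_upwards [hcont.eventually_lt_const hlt] with p hp
      rw [hemisphereKernel, h0, zero_div]
      rwa [Fin.insertNth_apply_same, ← mul_assoc, sign_mul_self, one_mul]
    exact contDiffAt_const.congr_of_eventuallyEq hev

theorem hemisphereKernel_of_nonpos (y : Fin n → ℝ) {w : ℝ} (hw : w ≤ 0) (e : ℝ) :
    hemisphereKernel i e σ y w = 0 := by
  -- The conventions √w = 0 for w ≤ 0 and c/0 = 0 extend the kernel by zero.
  rw [hemisphereKernel, Real.sqrt_eq_zero'.mpr hw, div_zero]

theorem contDiff_hemisphereKernel_sub (hσ : ContDiff ℝ ∞ σ) (hc : HasCompactSupport σ)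
    (hpos : ∀ x ∈ tsupport σ, 0 < ((ε : ℤ) : ℝ) * x i) :
    ContDiff ℝ ∞ fun p : ℝ × (Fin n → ℝ) =>
      hemisphereKernel i ((ε : ℤ) : ℝ) σ p.2 (p.1 - ∑ j, p.2 j ^ 2) :=
  (contDiff_hemisphereKernel hσ hc hpos).comp
    (by fun_prop : ContDiff ℝ ∞ fun p : ℝ × (Fin n → ℝ) => (p.2, p.1 - ∑ j, p.2 j ^ 2))

theorem sum_insertNth_sq (t : ℝ) (y : Fin n → ℝ) :
    ∑ A, (i.insertNth t y : Fin (n + 1) → ℝ) A ^ 2 = t ^ 2 + ∑ j, y j ^ 2 := by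
  rw [Fin.sum_univ_succAbove _ i]
  simp

/-- The support lies in the image of the support of σ under x ↦ (|x|², x without its i-th entry). -/
theorem hasCompactSupport_hemisphereKernel_sub (hc : HasCompactSupport σ) :
    HasCompactSupport fun p : ℝ × (Fin n → ℝ) =>
      hemisphereKernel i ((ε : ℤ) : ℝ) σ p.2 (p.1 - ∑ j, p.2 j ^ 2) := by
  refine HasCompactSupport.of_support_subset_isCompact (hc.isCompact.image
    (by fun_prop : Continuous fun x : Fin (n + 1) → ℝ =>
      (∑ A, x A ^ 2, fun j => x (i.succAbove j)))) ?_
  rintro ⟨u, y⟩ hp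
  have hw : 0 < u - ∑ j, y j ^ 2 := by
    by_contra h
    exact hp (hemisphereKernel_of_nonpos y (not_lt.mp h) _)
  refine ⟨i.insertNth (((ε : ℤ) : ℝ) * √(u - ∑ j, y j ^ 2)) y, subset_tsupport _ fun h => hp ?_, ?_⟩
  · simp only [hemisphereKernel, h, zero_div]
  · rw [Prod.mk.injEq, sum_insertNth_sq, mul_pow, Real.sq_sqrt hw.le, pow_two, sign_mul_self]
    exact ⟨by ring, by simp⟩

end HemisphereKernel

/-! ### Smooth dependence of slice integrals on the parameter -/

section ParametricIntegral

variable {E : Type*} [NormedAddCommGroup E] [NormedSpace ℝ E] {k : ℝ × E → ℝ}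
variable [MeasurableSpace E] [BorelSpace E] {μ : Measure E} [IsFiniteMeasureOnCompacts μ]

theorem contDiff_integral_slice (hk : ContDiff ℝ ∞ k) (hc : HasCompactSupport k) :
    ContDiff ℝ ∞ fun u => ∫ y, k (u, y) ∂μ := by
  rw [contDiff_infty]
  intro m
  induction m generalizing k with
  | zero =>
    rw [Nat.cast_zero, contDiff_zero, continuous_iff_continuousAt]
    exact fun u => (hasDerivAt_integral_slice hk hc u).continuousAt
  | succ m ih =>
    rw [Nat.cast_add, Nat.cast_one, contDiff_succ_iff_deriv]
    refine ⟨fun u => (hasDerivAt_integral_slice hk hc u).differentiableAt, by simp, ?_⟩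
    have h : deriv (fun u => ∫ y, k (u, y) ∂μ) = fun u => ∫ y, partialFst k (u, y) ∂μ :=
      funext fun v => (hasDerivAt_integral_slice hk hc v).deriv
    rw [h]
    exact ih (contDiff_partialFst hk) (hasCompactSupport_partialFst hc)

end ParametricIntegral

/-! ### Integrals over spherical shells -/

/-- The spherical shell of points whose squared norm lies in `(a, b]`. -/
def shell (N : ℕ) (a b : ℝ) : Set (Fin N → ℝ) := {x | ∑ i, x i ^ 2 ∈ Set.Ioc a b}

theorem measurableSet_shell (N : ℕ) (a b : ℝ) : MeasurableSet (shell N a b) :=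
  measurableSet_Ioc.preimage (by fun_prop : Continuous fun x : Fin N → ℝ => ∑ i, x i ^ 2).measurable

theorem volume_real_sum_sq_le (n : ℕ) {b : ℝ} (hb : 0 ≤ b) :
    volume.real {x : Fin (n + 1) → ℝ | ∑ i, x i ^ 2 ≤ b} =
      √b ^ (n + 1) * (√Real.pi ^ (n + 1) / Real.Gamma (((n : ℝ) + 1) / 2 + 1)) := by
  have h1 : {x : Fin (n + 1) → ℝ | ∑ i, x i ^ 2 ≤ b} =
      (WithLp.toLp 2) ⁻¹' Metric.closedBall (0 : EuclideanSpace ℝ (Fin (n + 1))) √b := by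
    ext x
    simp [EuclideanSpace.norm_eq, Real.sqrt_le_sqrt_iff hb]
  rw [Measure.real, h1, (PiLp.volume_preserving_toLp (Fin (n + 1))).measure_preimage
    Metric.isClosed_closedBall.measurableSet.nullMeasurableSet, EuclideanSpace.volume_closedBall,
    ENNReal.toReal_mul, ENNReal.toReal_pow, ENNReal.toReal_ofReal (Real.sqrt_nonneg _),
    ENNReal.toReal_ofReal, Fintype.card_fin]
  · push_cast; rfl
  · have : 0 < Real.Gamma ((Fintype.card (Fin (n + 1)) : ℝ) / 2 + 1) :=
      Real.Gamma_pos_of_pos (by positivity)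
    positivity

theorem isCompact_sum_sq_le (N : ℕ) (b : ℝ) : IsCompact {x : Fin N → ℝ | ∑ i, x i ^ 2 ≤ b} := by
  refine Metric.isCompact_of_isClosed_isBounded (isClosed_le (by fun_prop) continuous_const)
    ((Metric.isBounded_closedBall (x := (0 : Fin N → ℝ)) (r := √b)).subset fun x hx => ?_)
  rw [mem_closedBall_zero_iff, pi_norm_le_iff_of_nonneg (Real.sqrt_nonneg _)]
  intro i
  rw [Real.norm_eq_abs]
  exact Real.abs_le_sqrt ((Finset.single_le_sum (f := fun i => x i ^ 2)
    (fun _ _ => sq_nonneg _) (Finset.mem_univ i)).trans hx)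

theorem volume_real_shell (n : ℕ) {a b : ℝ} (ha : 0 ≤ a) (hab : a ≤ b) :
    volume.real (shell (n + 1) a b) = (√b ^ (n + 1) - √a ^ (n + 1)) *
      (√Real.pi ^ (n + 1) / Real.Gamma (((n : ℝ) + 1) / 2 + 1)) := by
  have h1 : shell (n + 1) a b = {x | ∑ i, x i ^ 2 ≤ b} \ {x | ∑ i, x i ^ 2 ≤ a} := by
    ext x
    exact ⟨fun h => ⟨h.2, not_le.mpr h.1⟩, fun h => ⟨not_le.mp h.2, h.1⟩⟩
  have h2 : {x : Fin (n + 1) → ℝ | ∑ i, x i ^ 2 ≤ a} ⊆ {x | ∑ i, x i ^ 2 ≤ b} :=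
    fun x hx => le_trans hx hab
  rw [h1, measureReal_sdiff h2
    (isCompact_sum_sq_le _ a).isClosed.measurableSet
    (isCompact_sum_sq_le _ b).measure_lt_top.ne, volume_real_sum_sq_le n ha,
    volume_real_sum_sq_le n (ha.trans hab), sub_mul]

section HemisphereKernel

variable {n : ℕ} {i : Fin (n + 1)} {ε : ℤˣ} {σ : (Fin (n + 1) → ℝ) → ℝ}

/-- Substitute w = t², so that dw/√w = 2 dt. The half line t > 0 extends to all t because σ vanishes
on the other side, and the sign ε is absorbed by reflection. -/
theorem setIntegral_hemisphereKernel (hσ : ∀ x, ((ε : ℤ) : ℝ) * x i ≤ 0 → σ x = 0)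
    (a b : ℝ) (y : Fin n → ℝ) :
    ∫ u in Set.Ioc a b, hemisphereKernel i ((ε : ℤ) : ℝ) σ y (u - ∑ j, y j ^ 2) =
      2 * ∫ t : ℝ, (shell (n + 1) a b).indicator σ (i.insertNth t y) := by
  classical
  set s := ∑ j, y j ^ 2 with hs
  set F : ℝ → ℝ := fun t => (shell (n + 1) a b).indicator σ (i.insertNth t y) with hF
  have hFt : ∀ t, F t = if t ^ 2 + s ∈ Set.Ioc a b then σ (i.insertNth t y) else 0 := by
    intro t
    simp only [hF, Set.indicator_apply, shell, Set.mem_ofPred_eq, sum_insertNth_sq, hs]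
  let G : ℝ → ℝ := fun w =>
    if w + s ∈ Set.Ioc a b then hemisphereKernel i ((ε : ℤ) : ℝ) σ y w else 0
  have h1 : ∫ u in Set.Ioc a b, hemisphereKernel i ((ε : ℤ) : ℝ) σ y (u - s) = ∫ w, G w := by
    rw [← integral_indicator measurableSet_Ioc, ← integral_add_right_eq_self _ s]
    refine integral_congr_ae (Filter.Eventually.of_forall fun w => ?_)
    simp only [Set.indicator_apply, add_sub_cancel_right, G]
  have h2 : ∫ w, G w = ∫ w in Set.Ioi 0, G w := by
    refine (setIntegral_eq_integral_of_forall_compl_eq_zero fun w hw => ?_).symm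
    simp only [G, hemisphereKernel_of_nonpos y (not_lt.mp hw), ite_self]
  have h3 : ∫ w in Set.Ioi 0, G w = ∫ t in Set.Ioi 0, 2 * F (((ε : ℤ) : ℝ) * t) := by
    rw [← integral_comp_rpow_Ioi_of_pos two_pos]
    refine setIntegral_congr_fun measurableSet_Ioi fun t ht => ?_
    have ht' : (0 : ℝ) < t := ht
    have h4 : (((ε : ℤ) : ℝ) * t) ^ 2 = t ^ 2 := by
      rw [mul_pow, pow_two, sign_mul_self, one_mul]
    simp only [hFt, h4, G, hemisphereKernel, Real.rpow_two, Real.sqrt_sq ht'.le, smul_eq_mul]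
    rw [show (2 : ℝ) - 1 = 1 by norm_num, Real.rpow_one]
    split_ifs
    · field_simp
    · simp
  have h4 : ∫ t in Set.Ioi 0, 2 * F (((ε : ℤ) : ℝ) * t) = ∫ t, 2 * F (((ε : ℤ) : ℝ) * t) := by
    refine setIntegral_eq_integral_of_forall_compl_eq_zero fun t ht => ?_
    rw [hFt, hσ, ite_self, mul_zero]
    rw [Fin.insertNth_apply_same, ← mul_assoc, sign_mul_self, one_mul]
    exact not_lt.mp ht
  rw [h1, h2, h3, h4, integral_const_mul]
  congr 1
  rcases Int.units_eq_one_or ε with rfl | rfl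
  · simp
  · simpa using integral_neg_eq_self F volume

/-- Fubini's theorem, with y and t = x_i reassembled into the point x. -/
theorem intervalIntegral_integral_hemisphereKernel (hσ : ContDiff ℝ ∞ σ)
    (hc : HasCompactSupport σ) (hpos : ∀ x ∈ tsupport σ, 0 < ((ε : ℤ) : ℝ) * x i) {a b : ℝ}
    (hab : a ≤ b) :
    ∫ u in a..b, ∫ y, hemisphereKernel i ((ε : ℤ) : ℝ) σ y (u - ∑ j, y j ^ 2) =
      2 * ∫ x in shell (n + 1) a b, σ x := by
  have hk := (contDiff_hemisphereKernel_sub hσ hc hpos).continuous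
  have hkc := hasCompactSupport_hemisphereKernel_sub (i := i) (ε := ε) hc
  have hint : Integrable (fun p : ℝ × (Fin n → ℝ) =>
      hemisphereKernel i ((ε : ℤ) : ℝ) σ p.2 (p.1 - ∑ j, p.2 j ^ 2))
      ((volume.restrict (Set.Ioc a b)).prod volume) := by
    have h := (hk.integrable_of_hasCompactSupport hkc (μ := volume.prod volume)).restrict
      (s := Set.Ioc a b ×ˢ Set.univ)
    rwa [← Measure.prod_restrict, Measure.restrict_univ] at h
  have h0 : ∀ x, ((ε : ℤ) : ℝ) * x i ≤ 0 → σ x = 0 := fun x hx =>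
    image_eq_zero_of_notMem_tsupport fun h => (hpos x h).not_ge hx
  have hF : Integrable ((shell (n + 1) a b).indicator σ) :=
    (hσ.continuous.integrable_of_hasCompactSupport hc).indicator (measurableSet_shell _ _ _)
  have hmp := (volume_preserving_piFinSuccAbove (fun _ : Fin (n + 1) => ℝ) i).symm
  have hF' : Integrable (fun p : ℝ × (Fin n → ℝ) =>
      (shell (n + 1) a b).indicator σ (i.insertNth p.1 p.2)) (volume.prod volume) :=
    hmp.integrable_comp_of_integrable hF
  rw [intervalIntegral.integral_of_le hab, integral_integral_swap hint]
  simp only [setIntegral_hemisphereKernel h0]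
  rw [integral_const_mul, ← integral_prod_symm _ hF', ← integral_indicator
    (measurableSet_shell _ _ _), ← hmp.integral_comp (MeasurableEquiv.measurableEmbedding _)]
  rfl

end HemisphereKernel

/-! ### Localization of a partition of unity near the sphere -/

/-- The deviation of |x|² from r has a positive minimum on the compact part of |x|² ≤ r + 1 outside
U. The bound 1 on η keeps x in that range. -/
theorem exists_sum_sq_nhds {N : ℕ} {r : ℝ} {U : Set (Fin N → ℝ)} (hU : IsOpen U)
    (h : ∀ x, ∑ i, x i ^ 2 = r → x ∈ U) :
    ∃ η > 0, ∀ x : Fin N → ℝ, |∑ i, x i ^ 2 - r| ≤ η → x ∈ U := by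
  have hK : IsCompact ({x : Fin N → ℝ | ∑ i, x i ^ 2 ≤ r + 1} \ U) :=
    (isCompact_sum_sq_le N (r + 1)).diff hU
  rcases ({x : Fin N → ℝ | ∑ i, x i ^ 2 ≤ r + 1} \ U).eq_empty_or_nonempty with he | hne
  · refine ⟨1, one_pos, fun x hx => ?_⟩
    by_contra hxU
    have : x ∈ {x : Fin N → ℝ | ∑ i, x i ^ 2 ≤ r + 1} \ U :=
      ⟨by have := (abs_le.mp hx).2; exact (by linarith : ∑ i, x i ^ 2 ≤ r + 1), hxU⟩
    rw [he] at this
    exact this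
  · obtain ⟨x₀, hx₀, hmin⟩ := hK.exists_isMinOn hne
      (f := fun x : Fin N → ℝ => |∑ i, x i ^ 2 - r|) (by fun_prop)
    have hpos : 0 < |∑ i, x₀ i ^ 2 - r| :=
      abs_pos.mpr fun h0 => hx₀.2 (h x₀ (sub_eq_zero.mp h0))
    refine ⟨min 1 (|∑ i, x₀ i ^ 2 - r| / 2), by positivity, fun x hx => ?_⟩
    by_contra hxU
    have hx1 : ∑ i, x i ^ 2 ≤ r + 1 := by
      have := (abs_le.mp (hx.trans (min_le_left _ _))).2
      linarith
    have h2 : |∑ i, x₀ i ^ 2 - r| ≤ |∑ i, x i ^ 2 - r| := hmin ⟨hx1, hxU⟩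
    have h3 := hx.trans (min_le_right _ _)
    linarith

/-- A hemisphere partition of unity can be cut off away from the sphere, so that its members
become compactly supported in open half spaces. -/
theorem IsHemispherePartition.exists_cutoff {n : ℕ} {R : ℝ} (hR : 0 < R)
    {ρ : Fin (n + 1) × ℤˣ → (Fin (n + 1) → ℝ) → ℝ} (hρ : IsHemispherePartition R ρ) :
    ∃ (a b : ℝ) (σ : Fin (n + 1) × ℤˣ → (Fin (n + 1) → ℝ) → ℝ),
      0 < a ∧ a < R ^ 2 ∧ R ^ 2 < b ∧ (∀ α, ContDiff ℝ ∞ (σ α)) ∧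
      (∀ α, HasCompactSupport (σ α)) ∧
      (∀ α, ∀ x ∈ tsupport (σ α), 0 < ((α.2 : ℤ) : ℝ) * x α.1) ∧
      (∀ x, ∑ i, x i ^ 2 ∈ Set.Icc a b → ∀ α, σ α x = ρ α x) ∧
      ∀ x, ∑ i, x i ^ 2 ∈ Set.Icc a b → ∑ α, σ α x = 1 := by
  -- An open neighbourhood of the sphere on which the functions sum to 1 and each support lies in
  -- its half space. It contains a whole shell.
  let U : Set (Fin (n + 1) → ℝ) := interior {x | ∑ α, ρ α x = 1} ∩
    ⋂ α, ((tsupport (ρ α))ᶜ ∪ {x | 0 < ((α.2 : ℤ) : ℝ) * x α.1})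
  have hU : IsOpen U := isOpen_interior.inter (isOpen_iInter_of_finite fun α =>
    (isClosed_tsupport _).isOpen_compl.union (isOpen_lt continuous_const (by fun_prop)))
  obtain ⟨η, hη, hηU⟩ := exists_sum_sq_nhds hU (r := R ^ 2) fun x hx => by
    refine ⟨mem_interior_iff_mem_nhds.mpr (hρ.sum_eq_one x hx), Set.mem_iInter.mpr fun α => ?_⟩
    by_cases h : x ∈ tsupport (ρ α)
    · exact Or.inr (hρ.support α x h hx)
    · exact Or.inl h
  have hR2 : 0 < R ^ 2 := by positivity
  -- The bound r ≤ R² makes the inner level a = R² − r/2 positive.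
  set r := min η (R ^ 2) with hr
  have hr0 : 0 < r := lt_min hη hR2
  let χ : ContDiffBump (R ^ 2) := ⟨r / 2, r, by linarith, by linarith⟩
  have hχ : ContDiff ℝ ∞ fun x : Fin (n + 1) → ℝ => χ (∑ i, x i ^ 2) :=
    χ.contDiff.comp (by fun_prop)
  have hχs : tsupport (fun x : Fin (n + 1) → ℝ => χ (∑ i, x i ^ 2)) ⊆
      {x | |∑ i, x i ^ 2 - R ^ 2| ≤ r} := by
    refine closure_minimal (fun x hx => ?_) (isClosed_le (by fun_prop) continuous_const)
    have h1 : ∑ i, x i ^ 2 ∈ Function.support χ := hx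
    rw [χ.support_eq, Metric.mem_ball, Real.dist_eq] at h1
    exact h1.le
  have h1 : ∀ x : Fin (n + 1) → ℝ, ∑ i, x i ^ 2 ∈ Set.Icc (R ^ 2 - r / 2) (R ^ 2 + r / 2) →
      |∑ i, x i ^ 2 - R ^ 2| ≤ r / 2 := fun x hx => by
    rw [abs_le]; constructor <;> linarith [hx.1, hx.2]
  have heq : ∀ x : Fin (n + 1) → ℝ, ∑ i, x i ^ 2 ∈ Set.Icc (R ^ 2 - r / 2) (R ^ 2 + r / 2) →
      ∀ α, χ (∑ i, x i ^ 2) * ρ α x = ρ α x := fun x hx α => by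
    rw [χ.one_of_mem_closedBall, one_mul]
    rw [Metric.mem_closedBall, Real.dist_eq]
    exact h1 x hx
  refine ⟨R ^ 2 - r / 2, R ^ 2 + r / 2, fun α x => χ (∑ i, x i ^ 2) * ρ α x, ?_, ?_, ?_,
    fun α => hχ.mul (hρ.smooth α), fun α => ?_, fun α x hx => ?_, heq, fun x hx => ?_⟩
  · linarith [min_le_right η (R ^ 2)]
  · linarith
  · linarith
  · refine HasCompactSupport.intro (isCompact_sum_sq_le (n + 1) (R ^ 2 + r)) fun x hx => ?_
    have hx' : x ∉ tsupport fun x : Fin (n + 1) → ℝ => χ (∑ i, x i ^ 2) := fun h => hx (by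
      have h' : |∑ i, x i ^ 2 - R ^ 2| ≤ r := hχs h
      have := (abs_le.mp h').2
      exact (by linarith : ∑ i, x i ^ 2 ≤ R ^ 2 + r))
    have := image_eq_zero_of_notMem_tsupport hx'
    simp only [this, zero_mul]
  · have h2 := hχs (tsupport_mul_subset_left hx)
    have h3 : x ∈ tsupport (ρ α) := tsupport_mul_subset_right hx
    have h4 := Set.mem_iInter.mp (hηU x (le_trans h2 (min_le_left _ _))).2 α
    exact h4.resolve_left fun h => h h3
  · have h2 := hηU x (((h1 x hx).trans (by linarith)).trans (min_le_left η (R ^ 2)))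
    rw [Finset.sum_congr rfl fun α _ => heq x hx α]
    have h3 : x ∈ {x | ∑ α, ρ α x = 1} := interior_subset h2.1
    exact h3

/-! ### The integral over a hemisphere chart -/

theorem iteratedDeriv_hemisphereKernel_of_nonpos {n : ℕ} {i : Fin (n + 1)} {ε : ℤˣ}
    {σ : (Fin (n + 1) → ℝ) → ℝ} (hc : HasCompactSupport σ)
    (hpos : ∀ x ∈ tsupport σ, 0 < ((ε : ℤ) : ℝ) * x i) (m : ℕ) (y : Fin n → ℝ) {w : ℝ}
    (hw : w ≤ 0) : iteratedDeriv m (hemisphereKernel i ((ε : ℤ) : ℝ) σ y) w = 0 := by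
  obtain ⟨δ, hδ, h0⟩ := exists_pos_forall_eq_zero hc hpos
  have hev : hemisphereKernel i ((ε : ℤ) : ℝ) σ y =ᶠ[nhds w] fun _ => 0 := by
    have hlt : √w < δ := by rwa [Real.sqrt_eq_zero'.mpr hw]
    filter_upwards [(Real.continuous_sqrt.continuousAt (x := w)).eventually_lt_const hlt] with v hv
    rw [hemisphereKernel, h0, zero_div]
    rwa [Fin.insertNth_apply_same, ← mul_assoc, sign_mul_self, one_mul]
  rw [hev.iteratedDeriv_eq, iteratedDeriv_fun_const_zero]

section HemisphereChart

variable {n m : ℕ} {R : ℝ} {i : Fin (n + 1)} {ε : ℤˣ} {Φ : SuperMap n (2 * m) (n + 1) (2 * m)}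

/-- The m-th derivative depends only on the germ, so ρ may be replaced by σ, which agrees with it on
a shell around the sphere. The domain may then be enlarged to all y, since the kernel of σ and its
derivatives vanish for w ≤ 0, and differentiation under the integral applies. -/
theorem IsHemisphereChart.integral_integrand (hΦ : IsHemisphereChart R i ε Φ) (hR : 0 < R)
    {ρ σ : (Fin (n + 1) → ℝ) → ℝ} (hρ : ContDiff ℝ ∞ ρ) (hσ : ContDiff ℝ ∞ σ)
    (hc : HasCompactSupport σ) (hpos : ∀ x ∈ tsupport σ, 0 < ((ε : ℤ) : ℝ) * x i) {a b : ℝ}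
    (ha : a < R ^ 2) (hb : R ^ 2 < b) (heq : ∀ x, ∑ i, x i ^ 2 ∈ Set.Icc a b → σ x = ρ x) :
    IntegrableOn (Φ.integrand (euclideanMetric (n + 1) m) ρ) Φ.domain ∧
    ∫ y in Φ.domain, Φ.integrand (euclideanMetric (n + 1) m) ρ y = 2 ^ m * R *
      iteratedDeriv m (fun u => ∫ y : Fin n → ℝ,
        hemisphereKernel i ((ε : ℤ) : ℝ) σ y (u - ∑ j, y j ^ 2)) (R ^ 2) := by
  have hk := contDiff_hemisphereKernel_sub hσ hc hpos
  have hkc := hasCompactSupport_hemisphereKernel_sub (i := i) (ε := ε) hc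
  obtain ⟨hint, hder⟩ := iteratedDeriv_integral_slice (μ := volume) m hk hkc (R ^ 2)
  simp only at hint hder
  have hshift : ∀ y : Fin n → ℝ, iteratedDeriv m
      (fun u => hemisphereKernel i ((ε : ℤ) : ℝ) σ y (u - ∑ j, y j ^ 2)) (R ^ 2) =
        iteratedDeriv m (hemisphereKernel i ((ε : ℤ) : ℝ) σ y) (R ^ 2 - ∑ j, y j ^ 2) := fun y => by
    rw [iteratedDeriv_comp_sub_const]
  simp only [hshift] at hint hder
  have hpt : ∀ y ∈ Φ.domain, Φ.integrand (euclideanMetric (n + 1) m) ρ y = 2 ^ m * R *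
      iteratedDeriv m (hemisphereKernel i ((ε : ℤ) : ℝ) σ y) (R ^ 2 - ∑ j, y j ^ 2) := by
    intro y hy
    rw [hΦ.integrand_eq hR hy hρ]
    congr 1
    refine Filter.EventuallyEq.iteratedDeriv_eq m ?_
    have h1 : Set.Ioo (a - ∑ j, y j ^ 2) (b - ∑ j, y j ^ 2) ∈ nhds (R ^ 2 - ∑ j, y j ^ 2) :=
      Ioo_mem_nhds (by linarith) (by linarith)
    filter_upwards [h1, lt_mem_nhds (hΦ.sub_pos hy)] with w hw hw0
    rw [hemisphereKernel, heq]
    rw [sum_insertNth_sq, mul_pow, Real.sq_sqrt hw0.le, pow_two, sign_mul_self, one_mul]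
    constructor <;> linarith [hw.1, hw.2]
  have hmeas : MeasurableSet Φ.domain := Φ.isOpen_domain.measurableSet
  constructor
  · exact (hint.const_mul (2 ^ m * R)).integrableOn.congr_fun (fun y hy => (hpt y hy).symm) hmeas
  · rw [setIntegral_congr_fun hmeas hpt, integral_const_mul, hder]
    congr 1
    refine setIntegral_eq_integral_of_forall_compl_eq_zero fun y hy => ?_
    refine iteratedDeriv_hemisphereKernel_of_nonpos hc hpos m y ?_
    rw [hΦ.domain_eq] at hy
    have : ¬ ∑ j, y j ^ 2 < R ^ 2 := hy
    linarith

end HemisphereChart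

/-! ### The total volume -/

theorem descPochhammer_eval_eq_Gamma_div (m : ℕ) {s : ℝ} (hs : 0 < s) :
    (descPochhammer ℝ m).eval (s - 1) = Real.Gamma s / Real.Gamma (s - m) := by
  induction m with
  | zero => simp [div_self (Real.Gamma_pos_of_pos hs).ne']
  | succ m ih =>
    rw [descPochhammer_succ_eval, ih]
    -- At t = s − 1 − m = 0 both sides vanish because Γ(0) is 0 by convention. For other t, Γ(t + 1)
    -- = tΓ(t) holds even at the poles.
    by_cases ht : s - 1 - m = 0
    · have h : s - ((m + 1 : ℕ) : ℝ) = 0 := by push_cast; linarith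
      rw [ht, h, Real.Gamma_zero, mul_zero, div_zero]
    · have h1 : s - m = (s - 1 - m) + 1 := by ring
      have h2 : s - ((m + 1 : ℕ) : ℝ) = s - 1 - m := by push_cast; ring
      rw [h1, h2, Real.Gamma_add_one ht, mul_comm (s - 1 - (m : ℝ)), div_mul_eq_mul_div,
        mul_div_mul_right _ _ ht]

/-- The integral of the sum over (a, u] is twice a shell volume, as the σ sum to 1 there.
Differentiating in u recovers the continuous integrand. The identity is needed near r, not only at
r, since m derivatives follow. -/
theorem sum_integral_hemisphereKernel {n : ℕ} {a b r : ℝ} (ha : 0 < a) (har : a < r) (hrb : r < b)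
    {σ : Fin (n + 1) × ℤˣ → (Fin (n + 1) → ℝ) → ℝ} (hσ : ∀ α, ContDiff ℝ ∞ (σ α))
    (hc : ∀ α, HasCompactSupport (σ α))
    (hpos : ∀ α, ∀ x ∈ tsupport (σ α), 0 < ((α.2 : ℤ) : ℝ) * x α.1)
    (hsum : ∀ x, ∑ i, x i ^ 2 ∈ Set.Icc a b → ∑ α, σ α x = 1) :
    (fun u => ∑ α, ∫ y : Fin n → ℝ,
      hemisphereKernel α.1 ((α.2 : ℤ) : ℝ) (σ α) y (u - ∑ j, y j ^ 2)) =ᶠ[nhds r]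
    fun u => (2 * Real.pi ^ (((n : ℝ) + 1) / 2) / Real.Gamma (((n : ℝ) + 1) / 2)) *
      u ^ (((n : ℝ) + 1) / 2 - 1) := by
  set s : ℝ := ((n : ℝ) + 1) / 2 with hs
  have hs0 : 0 < s := by positivity
  have hpow : ∀ v : ℝ, 0 ≤ v → √v ^ (n + 1) = v ^ s := fun v hv => by
    rw [Real.sqrt_eq_rpow, ← Real.rpow_natCast, ← Real.rpow_mul hv, hs]
    congr 1
    push_cast
    ring
  set Ψ : Fin (n + 1) × ℤˣ → ℝ → ℝ := fun α u => ∫ y : Fin n → ℝ,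
      hemisphereKernel α.1 ((α.2 : ℤ) : ℝ) (σ α) y (u - ∑ j, y j ^ 2) with hΨ
  have hcont : ∀ α, Continuous (Ψ α) := fun α =>
    (contDiff_integral_slice (contDiff_hemisphereKernel_sub (hσ α) (hc α) (hpos α))
      (hasCompactSupport_hemisphereKernel_sub (hc α))).continuous
  have hS : Continuous fun u => ∑ α, Ψ α u := continuous_finsetSum _ fun α _ => hcont α
  have hint : ∀ u ∈ Set.Ioo a b, ∫ v in a..u, ∑ α, Ψ α v =
      2 * ((u ^ s - a ^ s) * (Real.pi ^ s / Real.Gamma (s + 1))) := by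
    intro u hu
    rw [intervalIntegral.integral_finsetSum fun α _ => (hcont α).intervalIntegrable _ _]
    rw [Finset.sum_congr rfl fun α _ => intervalIntegral_integral_hemisphereKernel (hσ α) (hc α)
      (hpos α) hu.1.le, ← Finset.mul_sum, ← integral_finsetSum _ fun α _ =>
      ((hσ α).continuous.integrable_of_hasCompactSupport (hc α)).integrableOn,
      setIntegral_congr_fun (measurableSet_shell _ _ _) (g := fun _ => (1 : ℝ)) fun x hx =>
        hsum x ⟨hx.1.le, hx.2.trans hu.2.le⟩, setIntegral_const, smul_eq_mul, mul_one,
      volume_real_shell n ha.le hu.1.le, hpow u (ha.trans hu.1).le, hpow a ha.le,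
      hpow _ Real.pi_pos.le]
  filter_upwards [Ioo_mem_nhds har hrb] with u hu
  have hd1 : HasDerivAt (fun u => ∫ v in a..u, ∑ α, Ψ α v) (∑ α, Ψ α u) u :=
    (hS.integral_hasStrictDerivAt a u).hasDerivAt
  have hd2 : HasDerivAt (fun u => 2 * ((u ^ s - a ^ s) * (Real.pi ^ s / Real.Gamma (s + 1))))
      (2 * (s * u ^ (s - 1) * (Real.pi ^ s / Real.Gamma (s + 1)))) u :=
    (((Real.hasDerivAt_rpow_const (Or.inl (ha.trans hu.1).ne')).sub_const _).mul_const _).const_mul _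
  have hev : (fun u => ∫ v in a..u, ∑ α, Ψ α v) =ᶠ[nhds u]
      fun u => 2 * ((u ^ s - a ^ s) * (Real.pi ^ s / Real.Gamma (s + 1))) := by
    filter_upwards [Ioo_mem_nhds hu.1 hu.2] with v hv using hint v hv
  rw [hd1.unique (hd2.congr_of_eventuallyEq hev), Real.Gamma_add_one hs0.ne']
  have := (Real.Gamma_pos_of_pos hs0).ne'
  field_simp

theorem volume_constant_eq (n m : ℕ) {R : ℝ} (hR : 0 < R) :
    2 ^ m * R * ((2 * Real.pi ^ (((n : ℝ) + 1) / 2) / Real.Gamma (((n : ℝ) + 1) / 2)) *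
      ((descPochhammer ℝ m).eval (((n : ℝ) + 1) / 2 - 1) *
        (R ^ 2) ^ (((n : ℝ) + 1) / 2 - 1 - m))) =
    2 * R ^ ((n : ℤ) - 2 * (m : ℤ)) *
        (Real.pi ^ (((n : ℝ) + 1) / 2) * 2 ^ m / Real.Gamma (((n : ℝ) + 1) / 2 - (m : ℝ))) := by
  have hs0 : 0 < ((n : ℝ) + 1) / 2 := by positivity
  have hR1 : R * (R ^ 2) ^ (((n : ℝ) + 1) / 2 - 1 - m) = R ^ ((n : ℤ) - 2 * (m : ℤ)) := by
    rw [← Real.rpow_two, ← Real.rpow_mul hR.le, ← Real.rpow_intCast]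
    nth_rewrite 1 [← Real.rpow_one R]
    rw [← Real.rpow_add hR]
    congr 1
    push_cast
    ring
  rw [descPochhammer_eval_eq_Gamma_div m hs0, ← hR1]
  have := (Real.Gamma_pos_of_pos hs0).ne'
  field_simp

theorem hasSupersphereVolume (n m : ℕ) {R : ℝ} (hR : 0 < R) :
    HasSupersphereVolume n m R
      (2 * R ^ ((n : ℤ) - 2 * (m : ℤ)) *
        (Real.pi ^ (((n : ℝ) + 1) / 2) * 2 ^ m / Real.Gamma (((n : ℝ) + 1) / 2 - (m : ℝ)))) := by
  refine ⟨⟨fun α => hemisphereChart n m R α.1 α.2, fun α =>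
    isHemisphereChart_hemisphereChart n m R α.1 α.2⟩, exists_isHemispherePartition n hR,
    fun Φ ρ hΦ hρ => ?_⟩
  obtain ⟨a, b, σ, ha, haR, hRb, hσ, hc, hpos, heq, hsum⟩ := hρ.exists_cutoff hR
  have h := fun α => (hΦ α).integral_integrand hR (hρ.smooth α) (hσ α) (hc α) (hpos α) haR hRb
    fun x hx => heq x hx α
  refine ⟨fun α => (h α).1, ?_⟩
  rw [Finset.sum_congr rfl fun α _ => (h α).2, ← Finset.mul_sum,
    ← iteratedDeriv_fun_sum fun α _ => (contDiffAt_nat (contDiff_integral_slice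
      (contDiff_hemisphereKernel_sub (hσ α) (hc α) (hpos α))
      (hasCompactSupport_hemisphereKernel_sub (hc α))).contDiffAt m),
    (sum_integral_hemisphereKernel ha haR hRb hσ hc hpos hsum).iteratedDeriv_eq,
    iteratedDeriv_const_mul_field, iteratedDeriv_eq_iterate, Real.iter_deriv_rpow_const,
    volume_constant_eq n m hR]

end Supergeometry

end

theorem mainTheorem1 (R : ℝ) (hR : 0 < R) :
    (∀ n m : ℕ, Supergeometry.HasSupersphereVolume n m R
      (2 * R ^ ((n : ℤ) - 2 * (m : ℤ)) *
        (Real.pi ^ (((n : ℝ) + 1) / 2) * 2 ^ m / Real.Gamma (((n : ℝ) + 1) / 2 - (m : ℝ))))) ∧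
    (∀ n m : ℕ, n < m → Supergeometry.HasSupersphereVolume (2 * n + 1) m R 0) := by
  refine ⟨fun n m => Supergeometry.hasSupersphereVolume n m hR, fun n m hnm => ?_⟩
  have h := Supergeometry.hasSupersphereVolume (2 * n + 1) m hR
  -- The argument n + 1 − m is a pole of Γ when m > n. There `Real.Gamma` is 0, and division by 0
  -- gives 0, matching 1/Γ = 0.
  have harg : (((2 * n + 1 : ℕ) : ℝ) + 1) / 2 - (m : ℝ) = -((m - n - 1 : ℕ) : ℝ) := by
    rw [Nat.sub_sub, Nat.cast_sub hnm]
    push_cast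
    ring
  rwa [harg, Real.Gamma_neg_nat_eq_zero, div_zero, mul_zero] at h
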